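/- Let $D=(V,A)$ be an acyclic digraph with $V=\{1,\dots,n\}$, $n\ge 3$, and let $\bar D$ be the poset on $V$ given by the reflexive transitive closure of $D$. Let $\Omega(\bar D,x)$ be its order polynomial, i.e. the polynomial whose value at each positive integer $m$ is the number of order-preserving maps $\bar D\to\{1,\dots,m\}$. An ordering $\pi=(v_1,\dots,v_n)$ of $V$ is $D$-respecting if $(v_i,v_j)\in A$ implies $i<j$; let $\mathrm{OP}(D)$ be the set of these. Put $\delta_D(a,b)=1$ if $a<b$ or $(a,b)\in A$, and $\delta_D(a,b)=0$ otherwise; put $\delta_D(\pi)=\sum_{i=1}^{n-1}\delta_D(v_i,v_{i+1})$ and $$\Psi(D,x)=\sum_{\pi\in \mathrm{OP}(D)}\binom{x+\delta_D(\pi)}{n}.$$ For $v\in V$ let $R_D(v)$ be the set of vertices $w\ne v$ reachable from $v$ by a directed path. Let $W(D)$ be the set of $3$-element sets $\{a,b,c\}\subseteq V$ with $a<b<c$ such that $(c,a)\in A$, neither of $a,b$ is reachable from the other, and neither of $b,c$ is reachable from the other. Let $u\in V$ be such that either $u$ is a sink, or $\max(V\setminus R_D(u))<\min R_D(u)$ and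 $y<\min R_D(y)$ for every $y\in R_D(u)$ that is not a sink. Suppose that every member of $W(D)$ contains $u$. Then there are unique numbers $d_0,\dots,d_{n-3}$ such that $$\Psi(D,x)-\Omega(\bar D,x)=\sum_{j=0}^{n-3}d_j\binom{x+j}{n-2}$$ as polynomials in $x$, and, for each $j$, $d_j$ is the number of $D$-respecting orderings $\pi=(a_1,\dots,a_i,u,a_{i+1},\dots,a_{n-1})$ with $1\le i\le n-2$ and $\{a_i,u,a_{i+1}\}\in W(D)$ such that either (i) $\delta_D(\pi)=j+2$ and $a_i>a_{i+1}>u$; or (ii) $\delta_D(\pi)=j$ and $a_i>u>a_{i+1}$. -/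

import Mathlib

open Polynomial

namespace OrderPoly

/-! ### Binomial polynomials and order polynomials of finite posets -/

/-- The polynomial `binom (x + c) k` in the variable `x`, i.e.
`(x + c) (x + c - 1) ⋯ (x + c - k + 1) / k!`. -/
noncomputable def binomPoly (c k : ℕ) : ℚ[X] :=
  C ((k.factorial : ℚ)⁻¹) * (descPochhammer ℚ k).comp (X + C (c : ℚ))

theorem binomPoly_eval_natCast (c k m : ℕ) :
    (binomPoly c k).eval (m : ℚ) = ((m + c).choose k : ℚ) := by
  have h : ((k.factorial : ℕ) : ℚ) ≠ 0 := by exact_mod_cast k.factorial_ne_zero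
  simp only [binomPoly, eval_mul, eval_C, eval_comp, eval_add, eval_X]
  rw [← Nat.cast_add, descPochhammer_eval_eq_descFactorial,
    Nat.descFactorial_eq_factorial_mul_choose]
  push_cast
  field_simp

/-- The order polynomial of a finite poset `P`: the polynomial whose value at every positive
integer `m` is the number of order-preserving maps from `P` to an `m`-element chain
(see `orderPolynomial_eval_natCast`). The coefficient of `binom x k` is the number of
surjective order-preserving maps from `P` to a `k`-element chain. -/
noncomputable def orderPolynomial (P : Type*) [Fintype P] [PartialOrder P] : ℚ[X] :=
  ∑ k ∈ Finset.range (Fintype.card P + 1),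
    C (Nat.card {f : P →o Fin k // Function.Surjective f} : ℚ) * binomPoly 0 k

/-- The defining property of the order polynomial. -/
theorem orderPolynomial_eval_natCast (P : Type*) [Fintype P] [PartialOrder P] (m : ℕ) :
    (orderPolynomial P).eval (m : ℚ) = (Nat.card (P →o Fin m) : ℚ) := by
  classical
  set e : ℕ → ℕ := fun k => Nat.card {f : P →o Fin k // Function.Surjective f} with he
  have hfin : ∀ k : ℕ, Finite (P →o Fin k) := fun k =>
    Finite.of_injective (fun f : P →o Fin k => (f : P → Fin k)) DFunLike.coe_injective
  have he0 : ∀ k, Fintype.card P < k → e k = 0 := by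
    intro k hk
    have : IsEmpty {f : P →o Fin k // Function.Surjective f} := by
      refine ⟨fun f => ?_⟩
      have := Fintype.card_le_of_surjective _ f.2
      simp at this
      omega
    simp [he]
  have hcard : Nat.card (P →o Fin m) = ∑ s ∈ (Finset.univ : Finset (Fin m)).powerset, e s.card := by
    have hs : ∀ s : Finset (Fin m),
        Nat.card {f : P →o Fin m // Finset.univ.image f = s} = e s.card := by
      intro s
      let φ : Fin s.card ≃o s := s.orderIsoOfFin rfl
      have hmem : ∀ (f : {f : P →o Fin m // Finset.univ.image f = s}) (p : P), f.1 p ∈ s :=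
        fun f p => f.2.subset (Finset.mem_image_of_mem _ (Finset.mem_univ p))
      refine Nat.card_congr
        { toFun := fun f => ⟨⟨fun p => φ.symm ⟨f.1 p, hmem f p⟩, ?_⟩, ?_⟩
          invFun := fun g => ⟨⟨fun p => (φ (g.1 p) : Fin m), ?_⟩, ?_⟩
          left_inv := ?_
          right_inv := ?_ }
      · intro p q hpq
        exact φ.symm.monotone (f.1.monotone hpq)
      · intro i
        have hi : (φ i : Fin m) ∈ Finset.univ.image f.1 := by rw [f.2]; exact (φ i).2
        obtain ⟨p, -, hp⟩ := Finset.mem_image.1 hi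
        refine ⟨p, ?_⟩
        change φ.symm _ = i
        rw [OrderIso.symm_apply_eq]
        exact Subtype.ext hp
      · intro p q hpq
        exact φ.monotone (g.1.monotone hpq)
      · ext x
        simp only [Finset.mem_image, Finset.mem_univ, true_and]
        constructor
        · rintro ⟨p, rfl⟩
          exact (φ (g.1 p)).2
        · intro hx
          obtain ⟨p, hp⟩ := g.2 (φ.symm ⟨x, hx⟩)
          refine ⟨p, ?_⟩
          change (φ (g.1 p) : Fin m) = x
          rw [hp]
          simp
      · intro f
        apply Subtype.ext
        apply OrderHom.ext
        funext p
        exact congrArg Subtype.val (φ.apply_symm_apply ⟨f.1 p, hmem f p⟩)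
      · intro g
        apply Subtype.ext
        apply OrderHom.ext
        funext p
        exact φ.symm_apply_apply (g.1 p)
    rw [Finset.powerset_univ, ← Finset.sum_congr rfl (fun s _ => hs s)]
    have := hfin m
    rw [← Nat.card_sigma]
    exact Nat.card_congr (Equiv.sigmaFiberEquiv
      (fun f : P →o Fin m => Finset.univ.image f)).symm
  rw [hcard, Finset.sum_powerset_apply_card]
  simp only [orderPolynomial, eval_finsetSum, eval_mul, eval_C, binomPoly_eval_natCast,
    Finset.card_univ, Fintype.card_fin, add_zero, smul_eq_mul]
  push_cast
  have h1 : ∀ N M : ℕ, (∀ k, N < k → (e k : ℚ) * (m.choose k : ℚ) = 0) → N ≤ M →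
      ∑ k ∈ Finset.range (N + 1), (e k : ℚ) * (m.choose k : ℚ)
        = ∑ k ∈ Finset.range (M + 1), (e k : ℚ) * (m.choose k : ℚ) := by
    intro N M h hNM
    refine Finset.sum_subset (by simpa using hNM) ?_
    intro k _ hk
    exact h k (by simpa using hk)
  calc ∑ k ∈ Finset.range (Fintype.card P + 1), (e k : ℚ) * (m.choose k : ℚ)
      = ∑ k ∈ Finset.range (max (Fintype.card P) m + 1), (e k : ℚ) * (m.choose k : ℚ) :=
        h1 _ _ (fun k hk => by simp [he0 k hk]) (le_max_left _ _)
    _ = ∑ k ∈ Finset.range (m + 1), (e k : ℚ) * (m.choose k : ℚ) :=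
        (h1 _ _ (fun k hk => by simp [Nat.choose_eq_zero_of_lt hk]) (le_max_right _ _)).symm
    _ = _ := Finset.sum_congr rfl fun k _ => mul_comm _ _

/-! ### Acyclic digraphs -/

/-- `a ≺_D b`: there is a directed path (of positive length) from `a` to `b`. -/
def Reaches {V : Type*} (D : Digraph V) (a b : V) : Prop :=
  Relation.TransGen D.Adj a b

/-- `D` has no directed cycle. -/
def IsAcyclic {V : Type*} (D : Digraph V) : Prop :=
  ∀ v, ¬ Reaches D v v

/-- The poset `D̄` on the vertex set of an acyclic digraph: the reflexive transitive closure
of the arc relation. -/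
@[reducible]
def closurePoset {V : Type*} (D : Digraph V) (hD : IsAcyclic D) : PartialOrder V where
  le := Relation.ReflTransGen D.Adj
  le_refl _ := Relation.ReflTransGen.refl
  le_trans _ _ _ := Relation.ReflTransGen.trans
  le_antisymm a b hab hba := by
    rcases Relation.reflTransGen_iff_eq_or_transGen.1 hab with h | h
    · exact h.symm
    · exact absurd (h.trans_left hba) (hD a)

/-- `Ω(D̄, x)`, the order polynomial of the poset `D̄`. -/
noncomputable def omegaPoly {V : Type*} [Fintype V] (D : Digraph V) (hD : IsAcyclic D) : ℚ[X] :=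
  @orderPolynomial V _ (closurePoset D hD)

/-- A sink: a vertex without outgoing arcs. -/
def IsSink {V : Type*} (D : Digraph V) (u : V) : Prop :=
  ∀ v, ¬ D.Adj u v

/-- `R_D(u)`: the vertices other than `u` that can be reached from `u`. -/
def reachSet {V : Type*} (D : Digraph V) (u : V) : Set V :=
  {v | v ≠ u ∧ Reaches D u v}

/-- `OP(D)`: the `D`-respecting orderings, i.e. the lists containing each vertex exactly once
in which `a` appears before `b` for every arc `(a, b)`. -/
def respectingOrderings {V : Type*} (D : Digraph V) : Set (List V) :=
  {π | π.Nodup ∧ (∀ v, v ∈ π) ∧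
    ∀ i j : Fin π.length, D.Adj (π.get i) (π.get j) → i < j}

theorem finite_respectingOrderings {V : Type*} [Fintype V] (D : Digraph V) :
    (respectingOrderings D).Finite := by
  exact (List.finite_length_le V (Fintype.card V)).subset
    fun π hπ => hπ.1.length_le_card

open Classical in
/-- `δ_D(a, b)`. -/
noncomputable def delta {V : Type*} [LinearOrder V] (D : Digraph V) (a b : V) : ℕ :=
  if a < b ∨ D.Adj a b then 1 else 0

/-- `δ_D(π)`: the sum of `δ_D(a, b)` over consecutive entries `a, b` of `π`. -/
noncomputable def deltaList {V : Type*} [LinearOrder V] (D : Digraph V) (π : List V) : ℕ :=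
  (List.zipWith (delta D) π π.tail).sum

/-- `Ψ(D, x)`: the sum of `binom (x + δ_D(π)) n` over all `D`-respecting orderings `π`, where
`n` is the number of vertices. -/
noncomputable def psiPoly {V : Type*} [Fintype V] [LinearOrder V] (D : Digraph V) : ℚ[X] :=
  ∑ π ∈ (finite_respectingOrderings D).toFinset, binomPoly (deltaList D π) (Fintype.card V)

/-- `W(D)`: the 3-element sets `{a, b, c}` with `a < b < c` such that `(c, a)` is an arc and
`b` is incomparable (with respect to reachability) with both `a` and `c`. -/
def tripleSet {V : Type*} [LinearOrder V] (D : Digraph V) : Set (Finset V) :=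
  {W | ∃ a b c : V, W = {a, b, c} ∧ a < b ∧ b < c ∧ D.Adj c a ∧
    (¬ Reaches D a b ∧ ¬ Reaches D b a) ∧ (¬ Reaches D c b ∧ ¬ Reaches D b c)}

/-- The `D`-respecting orderings `π = (…, a, u, b, …)` such that `{a, u, b} ∈ W(D)` and either
`δ_D(π) = j + 2` and `a > b > u`, or `δ_D(π) = j` and `a > u > b`. -/
def specialOrderings {V : Type*} [LinearOrder V] (D : Digraph V) (u : V) (j : ℕ) :
    Set (List V) :=
  {π | π ∈ respectingOrderings D ∧ ∃ (l₁ l₂ : List V) (a b : V),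
    π = l₁ ++ [a, u, b] ++ l₂ ∧ ({a, u, b} : Finset V) ∈ tripleSet D ∧
      ((deltaList D π = j + 2 ∧ a > b ∧ b > u) ∨ (deltaList D π = j ∧ a > u ∧ u > b))}

end OrderPoly

/-! The value of Ψ at m counts pairs (f, π), where f maps into an m-chain, rises weakly along π, and
rises strictly at consecutive pairs with δ = 0 (`psiPoly_eval`). Such an f is order-preserving. For
a fixed order-preserving f, the admissible π are the topological orderings all of whose consecutive
pairs are steps: the key (f v, v) rises lexicographically, or there is an arc. A greedy ordering
always exists, so Ψ - Ω counts, over all f, the step orderings beyond one.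

Two distinct step orderings force an obstructing triple: keys a < b < c, an arc c → a, and b
incomparable to both. The arc forces f to be constant on it, so it lies in W(D) and contains u.
Hence deleting u leaves exactly one step ordering w (`Splitting.unique_erase`). Insert u into w at
every position: a one-dimensional crossing count shows that the positions giving step orderings
exceed by one those where u sits inside an arc a → b with b < u < a, incomparable to both. The
remaining step orderings are those broken by deleting u; there a → u is an arc and u < b < a. This
is `Splitting.ncard_chain_eq`.

Finally exchange the sums: a fixed π of either shape is counted by the maps f constant on its block
a, u, b. That leaves n - 2 blocks, hence a term binom(m + j, n - 2), where j is δ summed over the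
pairs avoiding u (`sum_special_eval`). -/

namespace OrderPoly

/-! ### Topological orderings made of steps: existence and uniqueness -/

section TopologicalOrderings

variable {V Λ : Type*} [LinearOrder Λ]

/-- `a` may be directly followed by `b` at no cost: the label increases, or there is an arc. -/
def Step (κ : V → Λ) (adj : V → V → Prop) (a b : V) : Prop :=
  κ a < κ b ∨ adj a b

/-- `a` and `b` are incomparable with respect to reachability. -/
def Incomp (adj : V → V → Prop) (a b : V) : Prop :=
  ¬ Relation.TransGen adj a b ∧ ¬ Relation.TransGen adj b a

/-- `l` lists the elements of `V` satisfying `p` once each, compatibly with `adj`. -/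
def IsTopo (adj : V → V → Prop) (p : V → Prop) (l : List V) : Prop :=
  l.Nodup ∧ (∀ v, v ∈ l ↔ p v) ∧ l.Pairwise fun a b => ¬ adj b a

theorem exists_minimal_of_acyclic [Finite V] {r : V → V → Prop}
    (hr : ∀ v, ¬ Relation.TransGen r v v) {s : Finset V} (hs : s.Nonempty) :
    ∃ a ∈ s, ∀ x ∈ s, ¬ r x a := by
  have : Std.Irrefl (Relation.TransGen r) := ⟨hr⟩
  have wf : WellFounded (Relation.TransGen r) := Finite.wellFounded_of_trans_of_irrefl _
  obtain ⟨a, ha, h⟩ := wf.has_min (s : Set V) hs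
  exact ⟨a, ha, fun x hx hxa => h x hx (.single hxa)⟩

/-- The greedy topological ordering, which always continues with the least available element. -/
theorem exists_isTopo_isChain [Finite V] {κ : V → Λ} {r : V → V → Prop}
    (hκ : Function.Injective κ) (hr : ∀ v, ¬ Relation.TransGen r v v) (s : Finset V) :
    ∃ l, IsTopo r (· ∈ s) l ∧ l.IsChain (Step κ r) := by
  classical
  generalize hk : s.card = k
  induction k generalizing s with
  | zero =>
    rw [Finset.card_eq_zero] at hk
    subst hk
    exact ⟨[], ⟨by simp, by simp, by simp⟩, by simp⟩
  | succ k ih =>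
    have hne : s.Nonempty := Finset.card_pos.1 (by omega)
    obtain ⟨a₀, ha₀, hmin₀⟩ := exists_minimal_of_acyclic hr hne
    obtain ⟨a, ha, hleast⟩ := Finset.exists_min_image (s.filter fun a => ∀ x ∈ s, ¬ r x a) κ
      ⟨a₀, by simpa using ⟨ha₀, hmin₀⟩⟩
    simp only [Finset.mem_filter] at ha hleast
    obtain ⟨l, ⟨hnd, hmem, hpw⟩, hch⟩ := ih (s.erase a)
      (by rw [Finset.card_erase_of_mem ha.1]; omega)
    replace hmem : ∀ v, v ∈ l ↔ v ∈ s.erase a := hmem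
    refine ⟨a :: l, ⟨?_, fun v => (?_ : v ∈ a :: l ↔ v ∈ s), ?_⟩, ?_⟩
    · refine List.nodup_cons.2 ⟨?_, hnd⟩
      rw [hmem]
      simp
    · rw [List.mem_cons, hmem, Finset.mem_erase]
      by_cases hva : v = a
      · simp [hva, ha.1]
      · simp [hva]
    · refine List.pairwise_cons.2 ⟨fun x hx => ?_, hpw⟩
      exact ha.2 x (Finset.mem_of_mem_erase ((hmem x).1 hx))
    · refine List.isChain_cons.2 ⟨fun b hb => ?_, hch⟩
      have hbl : b ∈ l := List.mem_of_mem_head? hb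
      have hbs := (hmem b).1 hbl
      have hbs' := Finset.mem_of_mem_erase hbs
      -- If `b` was already available alongside `a`, leastness of `a` gives a smaller key. Otherwise
      -- `b` heads the ordering of `s.erase a`, so its only predecessor in `s` can be `a`.
      by_cases hbm : ∀ x ∈ s, ¬ r x b
      · refine Or.inl (lt_of_le_of_ne (hleast b ⟨hbs', hbm⟩) ?_)
        exact fun h => (Finset.ne_of_mem_erase hbs) (hκ h).symm
      · push Not at hbm
        obtain ⟨x, hxs, hxb⟩ := hbm
        by_cases hxa : x = a
        · exact Or.inr (hxa ▸ hxb)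
        · exfalso
          have hp : ∀ y ∈ s.erase a, ¬ r y b := by
            intro y hy
            have hyl := (hmem y).2 hy
            cases l with
            | nil => simp at hbl
            | cons c l' =>
              simp only [List.head?_cons, Option.mem_def, Option.some.injEq] at hb
              subst hb
              rw [List.pairwise_cons] at hpw
              rcases List.mem_cons.1 hyl with h | h
              · subst h
                exact fun h => hr _ (.single h)
              · exact hpw.1 y h
          exact hp x (Finset.mem_erase.2 ⟨hxa, hxs⟩) hxb

/-- A path of steps that comes down to a lower level passes it somewhere. -/
theorem exists_crossing {κ : V → Λ} {E : V → V → Prop} {q : V} (s : List V) (p : V)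
    (h : (p :: (s ++ [q])).IsChain E) (hq : κ q < κ p) :
    ∃ c a, c ∈ p :: s ∧ (a ∈ s ∨ a = q) ∧ E c a ∧ κ q < κ c ∧ κ a ≤ κ q := by
  induction s generalizing p with
  | nil =>
    simp only [List.nil_append, List.isChain_cons_cons] at h
    exact ⟨p, q, by simp, Or.inr rfl, h.1, hq, le_rfl⟩
  | cons b s ih =>
    simp only [List.cons_append, List.isChain_cons_cons] at h
    by_cases hb : κ q < κ b
    · obtain ⟨c, a, hc, ha, h1, h2, h3⟩ := ih b h.2 hb
      exact ⟨c, a, List.mem_cons_of_mem _ hc, ha.imp_left (List.mem_cons_of_mem _), h1, h2, h3⟩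
    · exact ⟨p, b, by simp, by simp, h.1, hq, not_lt.1 hb⟩

/-- A chain from `p` down to `q` must cross the level of `q` by an arc `c → a`. If `a = q`, this
contradicts minimality of `q`. Otherwise `H` makes `q` comparable with `a` or `c`: a relation into
`q` contradicts minimality, and one out of `q` contradicts the order of the list, where `a` and `c`
come before `q`. -/
theorem not_isChain_of_lt_of_minimal {κ : V → Λ} {r R : V → V → Prop}
    (hκ : Function.Injective κ) {p q : V} {l : List V}
    (hpw : (p :: l).Pairwise fun a b => ¬ R b a)
    (hrR : ∀ a ∈ p :: l, ∀ b ∈ p :: l, r a b → R a b)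
    (H : ∀ a ∈ p :: l, ∀ c ∈ p :: l, ∀ b ∈ p :: l, κ a < κ b → κ b < κ c → r c a →
      R a b ∨ R b a ∨ R c b ∨ R b c)
    (hq : q ∈ l) (hqp : κ q < κ p) (hmin : ∀ x ∈ p :: l, x ≠ q → ¬ R x q) :
    ¬ (p :: l).IsChain (Step κ r) := by
  intro hch
  obtain ⟨s, t, rfl⟩ := List.append_of_mem hq
  have hch' : (p :: (s ++ [q])).IsChain (Step κ r) := by
    have : p :: (s ++ q :: t) = (p :: s) ++ q :: t := by simp
    rw [this, List.isChain_split] at hch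
    simpa using hch.1
  obtain ⟨c, a, hc, ha, hE, hqc, haq⟩ := exists_crossing s p hch' hqp
  have hcl : c ∈ p :: (s ++ q :: t) := by
    simp only [List.mem_cons, List.mem_append] at hc ⊢
    tauto
  have hal : a ∈ p :: (s ++ q :: t) := by
    simp only [List.mem_cons, List.mem_append] at ha ⊢
    tauto
  have hql : q ∈ p :: (s ++ q :: t) := by simp
  have hcq : c ≠ q := fun h => by simp [h] at hqc
  have hrca : r c a := hE.resolve_left (not_lt.2 (haq.trans hqc.le))
  by_cases haq' : a = q
  · subst haq'
    exact hmin c hcl hcq (hrR _ hcl _ hal hrca)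
  · have has : a ∈ p :: s := List.mem_cons_of_mem _ (ha.resolve_right haq')
    have hpw' : ((p :: s) ++ q :: t).Pairwise fun a b => ¬ R b a := by simpa using hpw
    rw [List.pairwise_append] at hpw'
    rcases H a hal c hcl q hql (lt_of_le_of_ne haq fun h => haq' (hκ h)) hqc hrca with h | h | h | h
    · exact hmin a hal haq' h
    · exact hpw'.2.2 a has q (by simp) h
    · exact hmin c hcl hcq h
    · exact hpw'.2.2 c hc q (by simp) h

/-- The head of each list is minimal in the other. If the heads differ, the list with the larger
head violates the preceding lemma; if they agree, remove them and induct. -/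
theorem isChain_topo_unique {κ : V → Λ} {r R : V → V → Prop} (hκ : Function.Injective κ)
    {l l' : List V} (hll : l.Perm l') (hnd : l.Nodup)
    (hpw : l.Pairwise fun a b => ¬ R b a) (hpw' : l'.Pairwise fun a b => ¬ R b a)
    (hrR : ∀ a ∈ l, ∀ b ∈ l, r a b → R a b)
    (H : ∀ a ∈ l, ∀ c ∈ l, ∀ b ∈ l, κ a < κ b → κ b < κ c → r c a →
      R a b ∨ R b a ∨ R c b ∨ R b c)
    (hch : l.IsChain (Step κ r)) (hch' : l'.IsChain (Step κ r)) : l = l' := by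
  induction l generalizing l' with
  | nil => exact (List.nil_perm.1 hll).symm
  | cons p l ih =>
    cases l' with
    | nil => simp at hll
    | cons q l' =>
      have hnd' := hll.nodup_iff.1 hnd
      have key : ∀ {p q : V} {l l' : List V}, (p :: l).Perm (q :: l') →
          (q :: l').Pairwise (fun a b => ¬ R b a) → p ≠ q →
          q ∈ l ∧ ∀ x ∈ p :: l, x ≠ q → ¬ R x q := by
        intro p q l l' hp hw hne
        constructor
        · have : q ∈ p :: l := hp.mem_iff.2 (by simp)
          exact (List.mem_cons.1 this).resolve_left (Ne.symm hne)
        · intro x hx hxq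
          have : x ∈ q :: l' := hp.mem_iff.1 hx
          exact (List.pairwise_cons.1 hw).1 x ((List.mem_cons.1 this).resolve_left hxq)
      by_cases hpq : p = q
      · subst hpq
        congr 1
        exact ih (List.perm_cons p |>.1 hll) (List.nodup_cons.1 hnd).2
          (List.pairwise_cons.1 hpw).2 (List.pairwise_cons.1 hpw').2
          (fun a ha b hb => hrR a (List.mem_cons_of_mem _ ha) b (List.mem_cons_of_mem _ hb))
          (fun a ha c hc b hb => H a (List.mem_cons_of_mem _ ha) c (List.mem_cons_of_mem _ hc)
            b (List.mem_cons_of_mem _ hb)) hch.tail hch'.tail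
      · exfalso
        rcases lt_or_gt_of_ne (hκ.ne hpq) with h | h
        · obtain ⟨h1, h2⟩ := key hll.symm hpw (Ne.symm hpq)
          have e : ∀ x, x ∈ q :: l' ↔ x ∈ p :: l := fun x => hll.mem_iff.symm
          refine not_isChain_of_lt_of_minimal hκ hpw' ?_ ?_ h1 h h2 hch'
          · simpa only [e] using hrR
          · simpa only [e] using H
        · obtain ⟨h1, h2⟩ := key hll hpw' hpq
          exact not_isChain_of_lt_of_minimal hκ hpw hrR H h1 h h2 hch

/-- In a topological ordering nothing is reachable from a later element. -/
theorem pairwise_not_transGen {r : V → V → Prop} (hr : ∀ v, ¬ r v v) {l : List V}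
    (hnd : l.Nodup) (hmem : ∀ a b, r a b → a ∈ l ∧ b ∈ l)
    (hpw : l.Pairwise fun a b => ¬ r b a) :
    l.Pairwise fun a b => ¬ Relation.TransGen r b a := by
  classical
  have h1 : ∀ a b, r a b → l.idxOf a < l.idxOf b := by
    intro a b hab
    obtain ⟨ha, hb⟩ := hmem a b hab
    rw [List.pairwise_iff_getElem] at hpw
    have hia := List.idxOf_lt_length_of_mem ha
    have hib := List.idxOf_lt_length_of_mem hb
    by_contra hlt
    rcases (not_lt.1 hlt).lt_or_eq with h | h
    · have := hpw _ _ hib hia h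
      rw [List.getElem_idxOf, List.getElem_idxOf] at this
      exact this hab
    · have : l[l.idxOf a] = l[l.idxOf b] := by simp [h]
      rw [List.getElem_idxOf, List.getElem_idxOf] at this
      exact hr a (by rw [← this] at hab; exact hab)
  have h2 : ∀ a b, Relation.TransGen r a b → l.idxOf a < l.idxOf b := by
    intro a b hab
    induction hab with
    | single h => exact h1 _ _ h
    | tail _ h ih => exact ih.trans (h1 _ _ h)
  rw [List.pairwise_iff_getElem]
  intro i j hi hj hij h
  have := h2 _ _ h
  rw [hnd.idxOf_getElem, hnd.idxOf_getElem] at this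
  omega

/-- A path either avoids a given vertex `u` or passes through it. -/
theorem transGen_avoid_or {r : V → V → Prop} {u x y : V} (hx : x ≠ u) (hy : y ≠ u)
    (h : Relation.TransGen r x y) :
    Relation.TransGen (fun a b => r a b ∧ a ≠ u ∧ b ≠ u) x y ∨
      (Relation.TransGen r x u ∧ Relation.TransGen r u y) := by
  induction h with
  | single h => exact Or.inl (.single ⟨h, hx, hy⟩)
  | @tail b c h1 h2 ih =>
    by_cases hb : b = u
    · subst hb
      exact Or.inr ⟨h1, .single h2⟩
    · rcases ih hb with h | h
      · exact Or.inl (h.tail ⟨h2, hb, hy⟩)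
      · exact Or.inr ⟨h.1, h.2.tail h2⟩

end TopologicalOrderings

/-! ### Inserting `u` into the unique step ordering of the other vertices -/

section InsertOne

variable {V Λ : Type*} [LinearOrder Λ]

/-- The vertex `u` is a sink of the down-closed part `¬ T`, which lies below `T`, and all triples
obstructing the uniqueness of step orderings contain `u`. -/
structure Splitting (κ : V → Λ) (adj : V → V → Prop) (u : V) (T : V → Prop) : Prop where
  inj : Function.Injective κ
  acyclic : ∀ v, ¬ Relation.TransGen adj v v
  up : ∀ {a b}, T a → adj a b → T b
  not_self : ¬ T u
  succ : ∀ {v}, adj u v → T v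
  lt : ∀ {x y}, ¬ T x → T y → κ x < κ y
  triple : ∀ {a b c}, κ a < κ b → κ b < κ c → adj c a → Incomp adj a b → Incomp adj c b →
    a = u ∨ b = u ∨ c = u

/-- `a → u` is an arc, and `u < b < a` with `b` incomparable to both. -/
def LowMiddle (κ : V → Λ) (adj : V → V → Prop) (u a b : V) : Prop :=
  κ u < κ b ∧ κ b < κ a ∧ adj a u ∧ Incomp adj b a ∧ Incomp adj b u

/-- `a → b` is an arc, and `b < u < a` with `u` incomparable to both. -/
def BetweenMiddle (κ : V → Λ) (adj : V → V → Prop) (u a b : V) : Prop :=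
  κ b < κ u ∧ κ u < κ a ∧ adj a b ∧ Incomp adj u a ∧ Incomp adj u b

/-- `l` consists of steps, except perhaps around `u`, whose neighbours in `l` satisfy `Q`. -/
def StepsAround (κ : V → Λ) (adj : V → V → Prop) (u : V) (Q : V → V → Prop) (l : List V) : Prop :=
  ∃ l₁ a b l₂, l = l₁ ++ a :: u :: b :: l₂ ∧ Q a b ∧
    (l₁ ++ [a]).IsChain (Step κ adj) ∧ (b :: l₂).IsChain (Step κ adj)

variable {κ : V → Λ} {adj : V → V → Prop} {u : V} {T : V → Prop}

namespace Splitting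

theorem irrefl (h : Splitting κ adj u T) (v : V) : ¬ adj v v := fun hv => h.acyclic v (.single hv)

theorem up_transGen (h : Splitting κ adj u T) {a b : V} (ha : T a)
    (hab : Relation.TransGen adj a b) : T b := by
  induction hab with
  | single h1 => exact h.up ha h1
  | tail _ h1 ih => exact h.up ih h1

theorem mem_of_reach (h : Splitting κ adj u T) {a : V} (hab : Relation.TransGen adj u a) : T a := by
  obtain ⟨b, hb, hba⟩ := Relation.TransGen.head'_iff.1 hab
  rcases Relation.reflTransGen_iff_eq_or_transGen.1 hba with rfl | hba
  · exact h.succ hb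
  · exact h.up_transGen (h.succ hb) hba

theorem not_mem_of_reach (h : Splitting κ adj u T) {a : V} (hab : Relation.TransGen adj a u) :
    ¬ T a := fun ha => h.not_self (h.up_transGen ha hab)

theorem mem_of_lt (h : Splitting κ adj u T) {a b : V} (ha : T a) (hab : κ a < κ b) : T b := by
  by_contra hb
  exact absurd (h.lt hb ha) (not_lt.2 hab.le)

theorem mem_of_step (h : Splitting κ adj u T) {a b : V} (ha : T a) (hab : Step κ adj a b) : T b :=
  hab.elim (h.mem_of_lt ha) (h.up ha)

/-- Erasing `u` leaves no obstructing triple, even with respect to paths avoiding `u`. -/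
theorem unique_erase (h : Splitting κ adj u T) {l l' : List V}
    (hl : IsTopo adj (· ≠ u) l) (hl' : IsTopo adj (· ≠ u) l')
    (hch : l.IsChain (Step κ adj)) (hch' : l'.IsChain (Step κ adj)) : l = l' := by
  set r : V → V → Prop := fun a b => adj a b ∧ a ≠ u ∧ b ≠ u with hr
  have hpw : ∀ {l : List V}, IsTopo adj (· ≠ u) l →
      l.Pairwise fun a b => ¬ Relation.TransGen r b a := fun {l} hl =>
    pairwise_not_transGen (fun v hv => h.irrefl v hv.1) hl.1
      (fun a b hab => ⟨(hl.2.1 a).2 hab.2.1, (hl.2.1 b).2 hab.2.2⟩)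
      (hl.2.2.imp fun hab h' => hab h'.1)
  refine isChain_topo_unique (R := Relation.TransGen r) h.inj ?_ hl.1 (hpw hl) (hpw hl') ?_ ?_
    hch hch'
  · rw [List.perm_ext_iff_of_nodup hl.1 hl'.1]
    intro a
    rw [hl.2.1 a, hl'.2.1 a]
  · intro a ha b hb hab
    exact .single ⟨hab, (hl.2.1 a).1 ha, (hl.2.1 b).1 hb⟩
  · intro a ha c hc b hb hab hbc hca
    have ha := (hl.2.1 a).1 ha
    have hb := (hl.2.1 b).1 hb
    have hc := (hl.2.1 c).1 hc
    by_contra hcon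
    push Not at hcon
    obtain ⟨n1, n2, n3, n4⟩ := hcon
    -- Avoiding `u` costs no comparability here: a path through `u` starts outside `T` and ends in
    -- `T`, but rising keys and the arc `c → a` would carry `T` from its end back to its start.
    refine absurd (h.triple hab hbc hca ⟨?_, ?_⟩ ⟨?_, ?_⟩) (by simp [ha, hb, hc])
    · intro hp
      obtain ⟨h1, h2⟩ := (transGen_avoid_or ha hb hp).resolve_left n1
      exact h.not_mem_of_reach h1 (h.up (h.mem_of_lt (h.mem_of_reach h2) hbc) hca)
    · intro hp
      obtain ⟨h1, h2⟩ := (transGen_avoid_or hb ha hp).resolve_left n2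
      exact h.not_mem_of_reach h1 (h.mem_of_lt (h.mem_of_reach h2) hab)
    · intro hp
      obtain ⟨h1, h2⟩ := (transGen_avoid_or hc hb hp).resolve_left n3
      exact h.not_mem_of_reach h1 (h.mem_of_lt (h.mem_of_reach h2) hbc)
    · intro hp
      obtain ⟨h1, h2⟩ := (transGen_avoid_or hb hc hp).resolve_left n4
      exact h.not_mem_of_reach h1 (h.mem_of_lt (h.up (h.mem_of_reach h2) hca) hab)

open Classical in
/-- The number of steps up across a level minus the number of steps down. -/
theorem card_up_eq_card_down (H : ℕ → Prop) (N : ℕ) :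
    ((Finset.range N).filter fun i => ¬ H i ∧ H (i + 1)).card + (if H 0 then 1 else 0) =
      ((Finset.range N).filter fun i => H i ∧ ¬ H (i + 1)).card + (if H N then 1 else 0) := by
  induction N with
  | zero => simp
  | succ N ih =>
    rw [Finset.range_add_one, Finset.filter_insert, Finset.filter_insert]
    by_cases h1 : H N <;> by_cases h2 : H (N + 1) <;> simp [h1, h2] at ih ⊢ <;> omega

/-- `l` is empty or starts above `u`, and contains no predecessor of `u`. -/
def Above (κ : V → Λ) (adj : V → V → Prop) (u : V) : List V → Prop
  | [] => True
  | x :: l => κ u < κ x ∧ ∀ y ∈ x :: l, ¬ adj y u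

theorem isTopo_insert_iff {l₁ l₂ : List V} :
    IsTopo adj (fun _ => True) (l₁ ++ u :: l₂) ↔
      IsTopo adj (· ≠ u) (l₁ ++ l₂) ∧ (∀ x ∈ l₁, ¬ adj u x) ∧ ∀ x ∈ l₂, ¬ adj x u := by
  classical
  have hperm : (l₁ ++ u :: l₂).Perm (u :: (l₁ ++ l₂)) := List.perm_middle
  constructor
  · rintro ⟨hnd, hmem, hpw⟩
    rw [hperm.nodup_iff, List.nodup_cons] at hnd
    simp only [List.pairwise_append, List.pairwise_cons, List.mem_cons] at hpw
    refine ⟨⟨hnd.2, fun v => ⟨?_, ?_⟩, ?_⟩, ?_, ?_⟩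
    · rintro hv rfl
      exact hnd.1 hv
    · intro hv
      have := (hmem v).2 trivial
      rw [hperm.mem_iff, List.mem_cons] at this
      exact this.resolve_left hv
    · rw [List.pairwise_append]
      exact ⟨hpw.1, hpw.2.1.2, fun a ha b hb => hpw.2.2 a ha b (Or.inr hb)⟩
    · exact fun x hx => hpw.2.2 x hx u (Or.inl rfl)
    · exact fun x hx => hpw.2.1.1 x hx
  · rintro ⟨⟨hnd, hmem, hpw⟩, h1, h2⟩
    refine ⟨?_, fun v => ⟨fun _ => trivial, fun _ => ?_⟩, ?_⟩
    · rw [hperm.nodup_iff, List.nodup_cons]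
      exact ⟨fun h => (hmem u).1 h rfl, hnd⟩
    · rw [hperm.mem_iff, List.mem_cons, hmem]
      exact em _
    · simp only [List.pairwise_append, List.pairwise_cons, List.mem_cons] at hpw ⊢
      refine ⟨hpw.1, ⟨h2, hpw.2.1⟩, ?_⟩
      rintro a ha b (rfl | hb)
      · exact h1 a ha
      · exact hpw.2.2 a ha b hb

theorem mem_last_of_mem (h : Splitting κ adj u T) {l : List V} {a x : V}
    (hch : (l ++ [a]).IsChain (Step κ adj)) (hx : x ∈ l) (hT : T x) : T a := by
  have : (l ++ [a]).IsChain fun x y => T x → T y := hch.imp fun x y hxy hTx => h.mem_of_step hTx hxy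
  have tr : Trans (fun x y => T x → T y) (fun x y => T x → T y) (fun x y => T x → T y) :=
    ⟨fun h1 h2 => h2 ∘ h1⟩
  have := List.pairwise_append.1 (List.isChain_iff_pairwise.1 this)
  exact this.2.2 x hx a (by simp) hT

/-- Successors of `u` lie in `T`, and steps never leave `T`. -/
theorem not_adj_of_not_mem (h : Splitting κ adj u T) {l : List V} {a : V}
    (hch : (l ++ [a]).IsChain (Step κ adj)) (ha : ¬ T a) : ∀ x ∈ l ++ [a], ¬ adj u x := by
  intro x hx hux
  rcases List.mem_append.1 hx with hx | hx
  · exact ha (h.mem_last_of_mem hch hx (h.succ hux))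
  · rw [List.mem_singleton.1 hx] at hux
    exact ha (h.succ hux)

/-- `Above` for `l₂` makes the right side legal; an arc from `u` gives nothing new, as it already
raises the key. Granted this, failure of `Above` for `a :: l₂` means exactly that `a` steps to `u`.
Then `a` is outside `T`, so no successor of `u` precedes it. -/
theorem insert_chain_iff (h : Splitting κ adj u T) {l₁ l₂ : List V}
    (hw : IsTopo adj (· ≠ u) (l₁ ++ l₂)) (hch : (l₁ ++ l₂).IsChain (Step κ adj)) :
    IsTopo adj (fun _ => True) (l₁ ++ u :: l₂) ∧ (l₁ ++ u :: l₂).IsChain (Step κ adj) ↔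
      ¬ (∃ l a, l₁ = l ++ [a] ∧ Above κ adj u (a :: l₂)) ∧ Above κ adj u l₂ := by
  rw [isTopo_insert_iff]
  constructor
  · rintro ⟨⟨-, h1, h2⟩, hc⟩
    constructor
    · rintro ⟨l, a, rfl, hlt, hadj⟩
      simp only [List.append_assoc, List.singleton_append, List.isChain_append_cons_cons] at hc
      rcases hc.2.1 with h3 | h3
      · exact lt_asymm hlt h3
      · exact hadj a (by simp) h3
    · cases l₂ with
      | nil => trivial
      | cons b l₂ =>
        rw [List.isChain_append_cons_cons] at hc
        refine ⟨?_, h2⟩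
        rcases hc.2.1 with h3 | h3
        · exact h3
        · exact h.lt h.not_self (h.succ h3)
  · rintro ⟨hn, hA⟩
    have h2 : ∀ x ∈ l₂, ¬ adj x u := by
      cases l₂ with
      | nil => simp
      | cons b l₂ => exact hA.2
    have hc2 : (u :: l₂).IsChain (Step κ adj) := by
      cases l₂ with
      | nil => simp
      | cons b l₂ => exact List.isChain_cons_cons.2 ⟨Or.inl hA.1, hch.right_of_append⟩
    rcases List.eq_nil_or_concat l₁ with rfl | ⟨l, a, rfl⟩
    · exact ⟨⟨hw, by simp, h2⟩, by simpa using hc2⟩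
    · rw [List.concat_eq_append] at *
      have hch1 : (l ++ [a]).IsChain (Step κ adj) := hch.left_of_append
      have hau : a ≠ u := (hw.2.1 a).1 (by simp)
      have hor : κ a < κ u ∨ adj a u := by
        by_contra hcon
        push Not at hcon
        refine hn ⟨l, a, rfl, lt_of_le_of_ne hcon.1 fun e => hau (h.inj e).symm, ?_⟩
        intro y hy
        rcases List.mem_cons.1 hy with rfl | hy
        · exact hcon.2
        · exact h2 y hy
      have hTa : ¬ T a := by
        rcases hor with h3 | h3
        · exact fun hT => h.not_self (h.mem_of_lt hT h3)
        · exact fun hT => h.not_self (h.up hT h3)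
      refine ⟨⟨hw, h.not_adj_of_not_mem hch1 hTa, h2⟩, ?_⟩
      rw [List.append_assoc, List.singleton_append, List.isChain_append_cons_cons]
      exact ⟨hch1, hor, hc2⟩

/-- The opposite crossing. No predecessor of `u` occurs from `a` on, so `Above` can fail for `b ::
l'` only by `b` lying below `u`; the descending step from `a` to `b` is then an arc. -/
theorem insert_around_iff (h : Splitting κ adj u T) {l₁ l₂ : List V}
    (hw : IsTopo adj (· ≠ u) (l₁ ++ l₂)) (hch : (l₁ ++ l₂).IsChain (Step κ adj)) :
    IsTopo adj (fun _ => True) (l₁ ++ u :: l₂) ∧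
        StepsAround κ adj u (BetweenMiddle κ adj u) (l₁ ++ u :: l₂) ↔
      (∃ l a, l₁ = l ++ [a] ∧ Above κ adj u (a :: l₂)) ∧ ¬ Above κ adj u l₂ := by
  constructor
  · rintro ⟨ht, l, a, b, l', heq, ⟨hbu, hua, hab, hia, hib⟩, -, -⟩
    obtain ⟨rfl, rfl⟩ : l₁ = l ++ [a] ∧ l₂ = b :: l' := by
      have hu : u ∉ l₁ := fun hu => (hw.2.1 u).1 (by simp [hu]) rfl
      have hu' : u ∉ l₂ := fun hu => (hw.2.1 u).1 (by simp [hu]) rfl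
      have heq' : l₁ ++ u :: l₂ = (l ++ [a]) ++ u :: (b :: l') := by simpa using heq
      obtain ⟨h1, -, h2⟩ := (List.append_cons_inj_of_notMem hu hu').1 heq'
      exact ⟨h1, h2⟩
    rw [isTopo_insert_iff] at ht
    refine ⟨⟨l, a, rfl, hua, ?_⟩, fun hA => lt_asymm hbu hA.1⟩
    intro y hy
    rcases List.mem_cons.1 hy with rfl | hy
    · exact fun h1 => hia.2 (.single h1)
    · exact ht.2.2 y hy
  · rintro ⟨⟨l, a, rfl, hua, hadj⟩, hA⟩
    cases l₂ with
    | nil => exact absurd trivial hA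
    | cons b l' =>
      have hbu : κ b < κ u := by
        have hbu : b ≠ u := (hw.2.1 b).1 (by simp)
        by_contra hcon
        exact hA ⟨lt_of_le_of_ne (not_lt.1 hcon) fun e => hbu (h.inj e).symm,
          fun y hy => hadj y (List.mem_cons_of_mem _ hy)⟩
      have hch' := hch
      rw [List.append_assoc, List.singleton_append, List.isChain_append_cons_cons] at hch'
      obtain ⟨hc1, hE, hc2⟩ := hch'
      have hab : adj a b := hE.resolve_left (not_lt.2 (hbu.trans hua).le)
      have hTb : ¬ T b := fun hT => h.not_self (h.mem_of_lt hT hbu)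
      have hTa : ¬ T a := fun hT => hTb (h.up hT hab)
      have ht : IsTopo adj (fun _ => True) ((l ++ [a]) ++ u :: b :: l') := by
        rw [isTopo_insert_iff]
        exact ⟨hw, h.not_adj_of_not_mem hc1 hTa, fun x hx => hadj x (List.mem_cons_of_mem _ hx)⟩
      have hpw := pairwise_not_transGen h.irrefl ht.1
        (fun x y _ => ⟨(ht.2.1 x).2 trivial, (ht.2.1 y).2 trivial⟩) ht.2.2
      -- The last vertex before `u` on such a path must lie in `l`, before `x`, yet it would equal
      -- or be reachable from `x`.
      have key : ∀ x ∈ a :: b :: l', ¬ Relation.TransGen adj x u := by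
        intro x hx hxu
        obtain ⟨y, hxy, hyu⟩ := Relation.TransGen.tail'_iff.1 hxu
        rcases Relation.reflTransGen_iff_eq_or_transGen.1 hxy with rfl | hxy
        · exact hadj _ hx hyu
        · have hy : y ∈ (l ++ [a]) ++ u :: b :: l' := (ht.2.1 y).2 trivial
          have hyl : y ∈ l := by
            have hya : y ∉ a :: b :: l' := fun hy' => hadj y hy' hyu
            have hyu' : y ≠ u := fun e => h.irrefl u (e ▸ hyu)
            simp only [List.mem_append, List.mem_cons, List.not_mem_nil, or_false] at hy hya
            tauto
          have hpw' : (l ++ a :: u :: b :: l').Pairwise fun a b => ¬ Relation.TransGen adj b a := by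
            simpa using hpw
          refine (List.pairwise_append.1 hpw').2.2 y hyl x ?_ hxy
          simp only [List.mem_cons] at hx ⊢
          tauto
      refine ⟨ht, l, a, b, l', by simp, ⟨hbu, hua, hab, ⟨?_, ?_⟩, ⟨?_, ?_⟩⟩, hc1, hc2⟩
      · exact fun h1 => hTa (h.mem_of_reach h1)
      · exact key a (by simp)
      · exact fun h1 => hTb (h.mem_of_reach h1)
      · exact key b (by simp)

end Splitting

theorem StepsAround.or_iff {Q Q' : V → V → Prop} {l : List V} :
    StepsAround κ adj u (fun a b => Q a b ∨ Q' a b) l ↔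
      StepsAround κ adj u Q l ∨ StepsAround κ adj u Q' l := by
  constructor
  · rintro ⟨l₁, a, b, l₂, h, h1 | h1, h2⟩
    · exact Or.inl ⟨l₁, a, b, l₂, h, h1, h2⟩
    · exact Or.inr ⟨l₁, a, b, l₂, h, h1, h2⟩
  · rintro (⟨l₁, a, b, l₂, h, h1, h2⟩ | ⟨l₁, a, b, l₂, h, h1, h2⟩)
    · exact ⟨l₁, a, b, l₂, h, Or.inl h1, h2⟩
    · exact ⟨l₁, a, b, l₂, h, Or.inr h1, h2⟩

/-- The neighbours of `u` in a list without duplicates are determined. -/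
theorem neighbours_unique {l₁ l₂ l l' : List V} {a b : V} (hnd : (l₁ ++ u :: l₂).Nodup)
    (h : l₁ ++ u :: l₂ = l ++ a :: u :: b :: l') : l₁ = l ++ [a] ∧ l₂ = b :: l' := by
  have h' : l₁ ++ u :: l₂ = (l ++ [a]) ++ u :: (b :: l') := by simpa using h
  rw [List.perm_middle.nodup_iff, List.nodup_cons, List.mem_append, not_or] at hnd
  obtain ⟨h1, -, h2⟩ := (List.append_cons_inj_of_notMem hnd.1.1 hnd.1.2).1 h'
  exact ⟨h1, h2⟩

namespace Splitting

/-- If only deleting `u` breaks the chain, then `a` does not step to `b`, so `b < a` with no arc.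
Since `u` lies below `b`, the step from `a` down to `u` must be an arc. -/
theorem chain_and_not_erase_iff (h : Splitting κ adj u T) {l₁ l₂ : List V}
    (ht : IsTopo adj (fun _ => True) (l₁ ++ u :: l₂)) :
    (l₁ ++ u :: l₂).IsChain (Step κ adj) ∧ ¬ (l₁ ++ l₂).IsChain (Step κ adj) ↔
      StepsAround κ adj u (LowMiddle κ adj u) (l₁ ++ u :: l₂) := by
  constructor
  · rintro ⟨hc, hn⟩
    rcases List.eq_nil_or_concat l₁ with rfl | ⟨l, a, rfl⟩
    · exact absurd hc.tail hn
    rw [List.concat_eq_append] at *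
    cases l₂ with
    | nil =>
      rw [List.append_nil] at hn
      exact absurd hc.left_of_append hn
    | cons b l' =>
      have e : (l ++ [a]) ++ u :: b :: l' = l ++ a :: u :: b :: l' := by simp
      rw [e] at hc ht ⊢
      rw [List.append_assoc, List.singleton_append, List.isChain_append_cons_cons] at hn
      rw [List.isChain_append_cons_cons, List.isChain_cons_cons] at hc
      obtain ⟨hc1, hau, hub, hc2⟩ := hc
      have hE : ¬ Step κ adj a b := fun hE => hn ⟨hc1, hE, hc2⟩
      have hnd := ht.1
      rw [List.nodup_append] at hnd
      have hne : a ≠ b := by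
        rintro rfl
        simp at hnd
      have hba : κ b < κ a :=
        lt_of_le_of_ne (not_lt.1 fun h' => hE (Or.inl h')) fun e => hne (h.inj e).symm
      have hub' : κ u < κ b := hub.elim id fun h' => h.lt h.not_self (h.succ h')
      have hau' : adj a u := hau.resolve_left (not_lt.2 (hub'.trans hba).le)
      have hTa : ¬ T a := fun hT => h.not_self (h.up hT hau')
      have hTb : ¬ T b := fun hT => hTa (h.mem_of_lt hT hba)
      have hpw := (pairwise_not_transGen h.irrefl ht.1
        (fun x y _ => ⟨(ht.2.1 x).2 trivial, (ht.2.1 y).2 trivial⟩) ht.2.2)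
      simp only [List.pairwise_append, List.pairwise_cons, List.mem_cons] at hpw
      obtain ⟨-, ⟨ha, hu, hb, -⟩, hl⟩ := hpw
      refine ⟨l, a, b, l', rfl, ⟨hub', hba, hau', ⟨?_, ?_⟩, ?_, ?_⟩, hc1, hc2⟩
      · exact ha b (Or.inr (Or.inl rfl))
      · intro hab
        -- The first vertex after `a` on the path has no possible place in the ordering; if it is
        -- `u`, then `b` would lie in `T`.
        obtain ⟨x, hax, hxb⟩ := Relation.TransGen.head'_iff.1 hab
        rcases Relation.reflTransGen_iff_eq_or_transGen.1 hxb with rfl | hxb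
        · exact hE (Or.inr hax)
        · have hx : x ∈ l ++ a :: u :: b :: l' := (ht.2.1 x).2 trivial
          simp only [List.mem_append, List.mem_cons] at hx
          rcases hx with hx | rfl | rfl | rfl | hx
          · exact hl x hx a (Or.inl rfl) (.single hax)
          · exact h.irrefl _ hax
          · exact hTb (h.mem_of_reach hxb)
          · exact h.acyclic _ hxb
          · exact hb x hx hxb
      · exact hu b (Or.inl rfl)
      · exact fun h' => hTb (h.mem_of_reach h')
  · rintro ⟨l, a, b, l', heq, ⟨hub, hba, hau, hi, -⟩, hc1, hc2⟩
    obtain ⟨rfl, rfl⟩ := neighbours_unique ht.1 heq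
    rw [heq, List.isChain_append_cons_cons, List.isChain_cons_cons, List.append_assoc,
      List.singleton_append, List.isChain_append_cons_cons]
    refine ⟨⟨hc1, Or.inr hau, Or.inl hub, hc2⟩, ?_⟩
    rintro ⟨-, h1 | h1, -⟩
    · exact lt_asymm h1 hba
    · exact hi.2 (.single h1)

theorem finite_isTopo [Finite V] (adj : V → V → Prop) (p : V → Prop) :
    {l | IsTopo adj p l}.Finite := by
  have := Fintype.ofFinite V
  exact (List.finite_length_le V (Fintype.card V)).subset fun l hl => hl.1.length_le_card

theorem exists_eq_append (l : List V) (hl : IsTopo adj (fun _ => True) l) (u : V) :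
    ∃ l₁ l₂, l = l₁ ++ u :: l₂ :=
  List.append_of_mem ((hl.2.1 u).2 trivial)

theorem ncard_chain_eq [Finite V] (h : Splitting κ adj u T) :
    {l | IsTopo adj (fun _ => True) l ∧ l.IsChain (Step κ adj)}.ncard =
      1 + {l | IsTopo adj (fun _ => True) l ∧ StepsAround κ adj u
        (fun a b => LowMiddle κ adj u a b ∨ BetweenMiddle κ adj u a b) l}.ncard := by
  classical
  have := Fintype.ofFinite V
  obtain ⟨w, hw, hwc⟩ : ∃ w, IsTopo adj (· ≠ u) w ∧ w.IsChain (Step κ adj) := by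
    obtain ⟨w, hw, hwc⟩ := exists_isTopo_isChain h.inj h.acyclic (Finset.univ.erase u)
    exact ⟨w, ⟨hw.1, fun v => (hw.2.1 v).trans (by simp), hw.2.2⟩, hwc⟩
  have huw : u ∉ w := fun hu => (hw.2.1 u).1 hu rfl
  set ins : ℕ → List V := fun i => w.take i ++ u :: w.drop i with hins
  -- The index is shifted by one: for a gap `i`, `H i` concerns the suffix starting with its left
  -- neighbour and `H (i + 1)` the suffix to its right. `H` is false at `0` and true at `w.length +
  -- 1` (empty suffix), which yields the surplus of one upward crossing.
  set H : ℕ → Prop := fun i => match i with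
    | 0 => False
    | i + 1 => Above κ adj u (w.drop i) with hH
  have hHi : ∀ i < w.length + 1,
      (H i ↔ ∃ l a, w.take i = l ++ [a] ∧ Above κ adj u (a :: w.drop i)) := by
    intro i hi
    cases i with
    | zero => simp [hH]
    | succ i =>
      have hi' : i < w.length := by omega
      have e1 : w.take (i + 1) = w.take i ++ [w[i]] := by simp
      have e2 : w.drop i = w[i] :: w.drop (i + 1) := by simp
      change Above κ adj u (w.drop i) ↔ _
      rw [e2, e1]
      constructor
      · intro hA
        exact ⟨_, _, rfl, hA⟩
      · rintro ⟨l, a, h1, h2⟩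
        obtain ⟨-, h3⟩ := List.append_inj' h1 rfl
        rw [List.cons.injEq] at h3
        rwa [h3.1]
  set A := (Finset.range (w.length + 1)).filter fun i => ¬ H i ∧ H (i + 1)
  set B := (Finset.range (w.length + 1)).filter fun i => H i ∧ ¬ H (i + 1)
  have hAB : A.card = 1 + B.card := by
    have h1 : A.card + (if H 0 then 1 else 0) =
        B.card + (if H (w.length + 1) then 1 else 0) := by
      convert card_up_eq_card_down H (w.length + 1)
    have h2 : H (w.length + 1) := by simp [hH, Above]
    have h3 : ¬ H 0 := by simp [hH]
    rw [if_neg h3, if_pos h2] at h1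
    omega
  have hw' : ∀ i, IsTopo adj (· ≠ u) (w.take i ++ w.drop i) := fun i => by
    rwa [List.take_append_drop]
  have hwc' : ∀ i, (w.take i ++ w.drop i).IsChain (Step κ adj) := fun i => by
    rwa [List.take_append_drop]
  have hA : ∀ i, i ∈ A ↔ i < w.length + 1 ∧
      (IsTopo adj (fun _ => True) (ins i) ∧ (ins i).IsChain (Step κ adj)) := by
    intro i
    rw [Finset.mem_filter, Finset.mem_range]
    refine and_congr_right fun hi => ?_
    rw [h.insert_chain_iff (hw' i) (hwc' i), hHi i hi]
  have hB : ∀ i, i ∈ B ↔ i < w.length + 1 ∧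
      (IsTopo adj (fun _ => True) (ins i) ∧
        StepsAround κ adj u (BetweenMiddle κ adj u) (ins i)) := by
    intro i
    rw [Finset.mem_filter, Finset.mem_range]
    refine and_congr_right fun hi => ?_
    rw [h.insert_around_iff (hw' i) (hwc' i), hHi i hi]
  have hinj : Set.InjOn ins (Set.Iio (w.length + 1)) := by
    intro i hi j hj hij
    have h1 : u ∉ w.take i := fun hu => huw (List.mem_of_mem_take hu)
    have h2 : u ∉ w.drop i := fun hu => huw (List.mem_of_mem_drop hu)
    have h3 := ((List.append_cons_inj_of_notMem h1 h2).1 hij).1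
    have h4 := congrArg List.length h3
    simp only [List.length_take, Set.mem_Iio] at h4 hi hj
    omega
  have hins_of : ∀ l₁ l₂, IsTopo adj (fun _ => True) (l₁ ++ u :: l₂) →
      (l₁ ++ l₂).IsChain (Step κ adj) → ∃ i < w.length + 1, ins i = l₁ ++ u :: l₂ := by
    intro l₁ l₂ ht hc
    have e : l₁ ++ l₂ = w := h.unique_erase (isTopo_insert_iff.1 ht).1 hw hc hwc
    refine ⟨l₁.length, ?_, ?_⟩
    · rw [← e, List.length_append]
      omega
    · simp [hins, ← e]
  set SL := {l | IsTopo adj (fun _ => True) l ∧ StepsAround κ adj u (LowMiddle κ adj u) l}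
  set SB := {l | IsTopo adj (fun _ => True) l ∧ StepsAround κ adj u (BetweenMiddle κ adj u) l}
  have hfin : ∀ P : List V → Prop, {l | IsTopo adj (fun _ => True) l ∧ P l}.Finite := fun P =>
    (finite_isTopo adj _).subset fun l hl => hl.1
  have eB : SB = ins '' (B : Set ℕ) := by
    ext l
    constructor
    · rintro ⟨ht, hl⟩
      obtain ⟨l₁, a, b, l₂, rfl, hQ, hc1, hc2⟩ := id hl
      have e : l₁ ++ a :: u :: b :: l₂ = (l₁ ++ [a]) ++ u :: b :: l₂ := by simp
      rw [e] at ht hl ⊢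
      obtain ⟨i, hi, hil⟩ := hins_of _ _ ht (by
        rw [List.append_assoc, List.singleton_append, List.isChain_append_cons_cons]
        exact ⟨hc1, Or.inr hQ.2.2.1, hc2⟩)
      refine ⟨i, Finset.mem_coe.2 ((hB i).2 ⟨hi, ?_⟩), hil⟩
      rw [hil]
      exact ⟨ht, hl⟩
    · rintro ⟨i, hi, rfl⟩
      exact ((hB i).1 hi).2
  have eA : {l | IsTopo adj (fun _ => True) l ∧ l.IsChain (Step κ adj)} =
      ins '' (A : Set ℕ) ∪ SL := by
    ext l
    constructor
    · rintro ⟨ht, hc⟩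
      obtain ⟨l₁, l₂, rfl⟩ := exists_eq_append l ht u
      by_cases hc' : (l₁ ++ l₂).IsChain (Step κ adj)
      · obtain ⟨i, hi, hil⟩ := hins_of _ _ ht hc'
        refine Or.inl ⟨i, Finset.mem_coe.2 ((hA i).2 ⟨hi, ?_⟩), hil⟩
        rw [hil]
        exact ⟨ht, hc⟩
      · exact Or.inr ⟨ht, (h.chain_and_not_erase_iff ht).1 ⟨hc, hc'⟩⟩
    · rintro (⟨i, hi, rfl⟩ | ⟨ht, hl⟩)
      · exact ((hA i).1 hi).2
      · obtain ⟨l₁, l₂, rfl⟩ := exists_eq_append l ht u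
        exact ⟨ht, ((h.chain_and_not_erase_iff ht).2 hl).1⟩
  have eS : {l | IsTopo adj (fun _ => True) l ∧ StepsAround κ adj u
      (fun a b => LowMiddle κ adj u a b ∨ BetweenMiddle κ adj u a b) l} = SB ∪ SL := by
    ext l
    simp only [Set.mem_ofPred_eq, Set.mem_union, StepsAround.or_iff, SB, SL]
    tauto
  have dA : Disjoint (ins '' (A : Set ℕ)) SL := by
    rw [Set.disjoint_left]
    rintro _ ⟨i, hi, rfl⟩ ⟨ht, hl⟩
    have := (h.chain_and_not_erase_iff (l₁ := w.take i) (l₂ := w.drop i) ht).2 hl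
    exact this.2 (hwc' i)
  have dB : Disjoint SB SL := by
    rw [eB, Set.disjoint_left]
    rintro _ ⟨i, hi, rfl⟩ ⟨ht, hl⟩
    have := (h.chain_and_not_erase_iff (l₁ := w.take i) (l₂ := w.drop i) ht).2 hl
    exact this.2 (hwc' i)
  have cA : (ins '' (A : Set ℕ)).ncard = A.card := by
    rw [Set.InjOn.ncard_image (hinj.mono fun i hi => ((hA i).1 hi).1), Set.ncard_coe_finset]
  have cB : SB.ncard = B.card := by
    rw [eB, Set.InjOn.ncard_image (hinj.mono fun i hi => ((hB i).1 hi).1),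
      Set.ncard_coe_finset]
  rw [eA, eS, Set.ncard_union_eq dA (A.finite_toSet.image _) (hfin _),
    Set.ncard_union_eq dB (hfin _) (hfin _), cA, cB, hAB, add_assoc]

end Splitting

end InsertOne

/-! ### Counting maps constrained along a list -/

section Counting

variable {V : Type*}

/-- The sum of `g a b` over consecutive entries `a, b` of a list. -/
def adjSum (g : V → V → ℕ) (l : List V) : ℕ :=
  (List.zipWith g l l.tail).sum

@[simp] theorem adjSum_singleton (g : V → V → ℕ) (a : V) : adjSum g [a] = 0 := rfl

@[simp] theorem adjSum_cons_cons (g : V → V → ℕ) (a b : V) (l : List V) :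
    adjSum g (a :: b :: l) = g a b + adjSum g (b :: l) := by
  simp [adjSum]

theorem adjSum_append_cons (g : V → V → ℕ) (l₁ : List V) (a : V) (l₂ : List V) :
    adjSum g (l₁ ++ a :: l₂) = adjSum g (l₁ ++ [a]) + adjSum g (a :: l₂) := by
  induction l₁ with
  | nil => simp
  | cons x l₁ ih =>
    cases l₁ with
    | nil => simp
    | cons y l₁ =>
      simp only [List.cons_append, adjSum_cons_cons] at ih ⊢
      rw [ih, add_assoc]

theorem adjSum_le_adjSum {g h : V → V → ℕ} (l : List V)
    (H : ∀ a ∈ l, ∀ b ∈ l, g a b ≤ h a b) : adjSum g l ≤ adjSum h l := by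
  induction l with
  | nil => simp [adjSum]
  | cons x l ih =>
    cases l with
    | nil => simp
    | cons y l =>
      rw [adjSum_cons_cons, adjSum_cons_cons]
      exact add_le_add (H x (by simp) y (by simp)) (ih fun a ha b hb =>
        H a (List.mem_cons_of_mem _ ha) b (List.mem_cons_of_mem _ hb))

theorem adjSum_congr {g h : V → V → ℕ} (l : List V)
    (H : ∀ a ∈ l, ∀ b ∈ l, g a b = h a b) : adjSum g l = adjSum h l :=
  le_antisymm (adjSum_le_adjSum l fun a ha b hb => (H a ha b hb).le)
    (adjSum_le_adjSum l fun a ha b hb => (H a ha b hb).ge)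

theorem adjSum_one (l : List V) : adjSum (fun _ _ => 1) l = l.length - 1 := by
  induction l with
  | nil => simp [adjSum]
  | cons x l ih =>
    cases l with
    | nil => simp
    | cons y l =>
      rw [adjSum_cons_cons, ih]
      simp
      omega

/-- Hockey-stick identity; `L ≤ K` makes the right side vanish at `N = 0`. -/
theorem sum_choose_add {L K : ℕ} (h : L ≤ K) (N : ℕ) :
    ∑ j ∈ Finset.range N, (j + L).choose K = (N + L).choose (K + 1) := by
  induction N with
  | zero => simp [Nat.choose_eq_zero_of_lt (Nat.lt_succ_of_le h)]
  | succ N ih =>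
    rw [Finset.sum_range_succ, ih, add_right_comm, Nat.choose_succ_succ, add_comm]

theorem sum_choose_sub {L K d m x : ℕ} (h : L ≤ K) (hd : d ≤ 1) (hx : x < m) :
    ∑ y ∈ (Finset.range m).filter (fun y => x + 1 ≤ y + d), (m - 1 - y + L).choose K =
      (m - 1 - x + (d + L)).choose (K + 1) := by
  have e : (Finset.range m).filter (fun y => x + 1 ≤ y + d) = Finset.Ico (x + 1 - d) m := by
    ext y
    simp only [Finset.mem_filter, Finset.mem_range, Finset.mem_Ico]
    omega
  rw [e, Finset.sum_Ico_eq_sum_range, ← Finset.sum_range_reflect]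
  have e2 : m - 1 - x + (d + L) = (m - (x + 1 - d)) + L := by omega
  rw [e2, ← sum_choose_add h]
  refine Finset.sum_congr rfl fun j hj => ?_
  rw [Finset.mem_range] at hj
  congr 2
  omega

theorem ncard_eq_sum_fiber {α β : Type*} [Finite α] [Fintype β] (S : Set α) (g : α → β) :
    S.ncard = ∑ y, {f | f ∈ S ∧ g f = y}.ncard := by
  classical
  have := Fintype.ofFinite α
  rw [Set.ncard_eq_toFinset_card', Finset.card_eq_sum_card_fiberwise (f := g)
    (t := Finset.univ) (fun _ _ => by simp)]
  refine Finset.sum_congr rfl fun y _ => ?_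
  rw [Set.ncard_eq_toFinset_card']
  congr 1
  ext f
  simp

variable {m : ℕ} (e : V → V → Prop) (d : V → V → ℕ)

/-- Equality on pairs satisfying `e`; otherwise a weak or strict inequality according to whether
`d` is `1` or `0`. -/
def Gap (f : V → Fin m) (a b : V) : Prop :=
  (e a b → f a = f b) ∧ (¬ e a b → (f a : ℕ) + 1 ≤ f b + d a b)

open Classical in
/-- `d` outside of the pairs satisfying `e`. -/
noncomputable def offSum (l : List V) : ℕ := adjSum (fun a b => if e a b then 0 else d a b) l

/-- Fixing `f` off `l` pins the value at `v`, with `m - 1 - f₀ v` values above it. Summing over the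
value at the next entry changes nothing for a pair in `e`; for any other pair it is a hockey-stick
sum, raising the lower index by one and the upper by `d`. -/
theorem ncard_gap_chain_aux [Finite V] (hd : ∀ a b, d a b ≤ 1) (l : List V) (v : V)
    (hnd : (v :: l).Nodup) (f₀ : V → Fin m) :
    {f : V → Fin m | (∀ x ∉ l, f x = f₀ x) ∧ (v :: l).IsChain (Gap e d f)}.ncard =
      (m - 1 - f₀ v + offSum e d (v :: l)).choose (offSum e (fun _ _ => 1) (v :: l)) := by
  classical
  induction l generalizing v f₀ with
  | nil =>
    have : {f : V → Fin m | (∀ x ∉ [], f x = f₀ x) ∧ [v].IsChain (Gap e d f)} = {f₀} := by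
      ext f
      simp [funext_iff]
    rw [this]
    simp [offSum]
  | cons w l ih =>
    have hle : offSum e d (w :: l) ≤ offSum e (fun _ _ => 1) (w :: l) := by
      refine adjSum_le_adjSum _ fun a _ b _ => ?_
      split_ifs
      · exact le_rfl
      · exact hd a b
    obtain ⟨hv, hnd'⟩ := List.nodup_cons.1 hnd
    have hwl : w ∉ l := (List.nodup_cons.1 hnd').1
    rw [ncard_eq_sum_fiber _ fun f => f w]
    have key : ∀ y : Fin m, {f : V → Fin m | f ∈ {f : V → Fin m | (∀ x ∉ w :: l, f x = f₀ x) ∧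
        (v :: w :: l).IsChain (Gap e d f)} ∧ f w = y}.ncard =
        if (e v w → f₀ v = y) ∧ (¬ e v w → (f₀ v : ℕ) + 1 ≤ y + d v w) then
          (m - 1 - y + offSum e d (w :: l)).choose (offSum e (fun _ _ => 1) (w :: l)) else 0 := by
      intro y
      have hiff : ∀ f : V → Fin m, f ∈ {f | f ∈ {f : V → Fin m | (∀ x ∉ w :: l, f x = f₀ x) ∧
          (v :: w :: l).IsChain (Gap e d f)} ∧ f w = y} ↔
          ((e v w → f₀ v = y) ∧ (¬ e v w → (f₀ v : ℕ) + 1 ≤ y + d v w)) ∧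
          ((∀ x ∉ l, f x = Function.update f₀ w y x) ∧ (w :: l).IsChain (Gap e d f)) := by
        intro f
        simp only [Set.mem_ofPred_eq, List.isChain_cons_cons]
        constructor
        · rintro ⟨⟨h1, h2, h3⟩, rfl⟩
          refine ⟨?_, ?_, h3⟩
          · rw [← h1 v hv]
            exact h2
          · intro x hx
            by_cases hxw : x = w
            · subst hxw
              simp
            · rw [Function.update_of_ne hxw]
              exact h1 x (by simp [hxw, hx])
        · rintro ⟨h1, h2, h3⟩
          have hw : f w = y := by simpa using h2 w hwl
          have h4 : ∀ x ∉ w :: l, f x = f₀ x := by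
            intro x hx
            simp only [List.mem_cons, not_or] at hx
            rw [h2 x hx.2, Function.update_of_ne hx.1]
          refine ⟨⟨h4, ?_, h3⟩, hw⟩
          rw [Gap, h4 v hv, hw]
          exact h1
      split_ifs with hc
      · have := ih w hnd' (Function.update f₀ w y)
        rw [Function.update_self] at this
        rw [← this]
        congr 1
        ext f
        rw [hiff]
        exact and_iff_right hc
      · rw [Set.ncard_eq_zero]
        ext f
        rw [hiff]
        exact iff_of_false (fun h => hc h.1) (Set.notMem_empty f)
    rw [Finset.sum_congr rfl fun y _ => key y]
    by_cases he : e v w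
    · have e1 : ∀ g : V → V → ℕ, offSum e g (v :: w :: l) = offSum e g (w :: l) := by
        intro g
        simp [offSum, he]
      simp only [he, true_implies, not_true, false_implies, and_true, e1]
      rw [Finset.sum_ite_eq]
      simp
    · have e1 : ∀ g : V → V → ℕ, offSum e g (v :: w :: l) = g v w + offSum e g (w :: l) := by
        intro g
        simp [offSum, he]
      simp only [he, false_implies, not_false_eq_true, true_implies, true_and, e1]
      rw [Fin.sum_univ_eq_sum_range (fun y => if (f₀ v : ℕ) + 1 ≤ y + d v w then
        (m - 1 - y + offSum e d (w :: l)).choose (offSum e (fun _ _ => 1) (w :: l)) else 0),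
        ← Finset.sum_filter, sum_choose_sub hle (hd v w) (f₀ v).2, add_comm 1]

/-- The number of maps to an `m`-element chain satisfying the given constraints along a list
containing every element once. -/
theorem ncard_gap_chain [Finite V] (hd : ∀ a b, d a b ≤ 1) {l : List V} (hne : l ≠ [])
    (hnd : l.Nodup) (hmem : ∀ v, v ∈ l) :
    {f : V → Fin m | l.IsChain (Gap e d f)}.ncard =
      (m + offSum e d l).choose (offSum e (fun _ _ => 1) l + 1) := by
  classical
  cases l with
  | nil => exact absurd rfl hne
  | cons v l =>
    have hle : offSum e d (v :: l) ≤ offSum e (fun _ _ => 1) (v :: l) := by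
      refine adjSum_le_adjSum _ fun a _ b _ => ?_
      split_ifs
      · exact le_rfl
      · exact hd a b
    rw [ncard_eq_sum_fiber _ fun f => f v]
    have key : ∀ y : Fin m, {f : V → Fin m | f ∈ {f : V → Fin m |
        (v :: l).IsChain (Gap e d f)} ∧ f v = y}.ncard =
          (m - 1 - y + offSum e d (v :: l)).choose (offSum e (fun _ _ => 1) (v :: l)) := by
      intro y
      rw [← ncard_gap_chain_aux e d hd l v hnd fun _ => y]
      congr 1
      ext f
      simp only [Set.mem_ofPred_eq]
      rw [and_comm]
      refine and_congr_left fun _ => ⟨?_, fun h => h v (List.nodup_cons.1 hnd).1⟩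
      rintro h x hx
      rw [(List.mem_cons.1 (hmem x)).resolve_right hx, h]
    rw [Finset.sum_congr rfl fun y _ => key y, Fin.sum_univ_eq_sum_range
      (fun y => (m - 1 - y + offSum e d (v :: l)).choose (offSum e (fun _ _ => 1) (v :: l))),
      Finset.sum_range_reflect
      (fun y => (y + offSum e d (v :: l)).choose (offSum e (fun _ _ => 1) (v :: l))),
      sum_choose_add hle]

theorem sum_ncard_comm {α β : Type*} [Fintype β] (s : Finset α) (P : α → β → Prop) :
    ∑ a ∈ s, {b | P a b}.ncard = ∑ b, {a | a ∈ s ∧ P a b}.ncard := by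
  classical
  have h1 : ∀ a, {b | P a b}.ncard = ∑ b, if P a b then 1 else 0 := fun a => by
    rw [← Finset.card_filter, Set.ncard_eq_toFinset_card']
    congr 1
    ext
    simp
  have h2 : ∀ b, {a | a ∈ s ∧ P a b}.ncard = ∑ a ∈ s, if P a b then 1 else 0 := fun b => by
    rw [← Finset.card_filter, ← Set.ncard_coe_finset]
    congr 1
    ext
    simp
  simp only [h1, h2]
  exact Finset.sum_comm

end Counting

/-! ### Linear independence of the binomial basis -/

section Independence

/-- Downward induction on `j`: at `m = k + 1 - j` the `j`-th binomial is `1`, those of smaller index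
vanish, and the larger coefficients are already zero. -/
theorem eq_zero_of_sum_binomPoly_eq_zero {k : ℕ} {c : Fin (k + 1) → ℚ}
    (h : ∑ j : Fin (k + 1), C (c j) * binomPoly (j : ℕ) (k + 1) = 0) (j : Fin (k + 1)) :
    c j = 0 := by
  have hev : ∀ m : ℕ, ∑ j : Fin (k + 1), c j * ((m + j).choose (k + 1) : ℚ) = 0 := by
    intro m
    have := congrArg (eval (m : ℚ)) h
    simpa only [eval_finsetSum, eval_mul, eval_C, binomPoly_eval_natCast, eval_zero] using this
  suffices H : ∀ i : ℕ, ∀ j : Fin (k + 1), k - j = i → c j = 0 from H _ j rfl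
  intro i
  induction i using Nat.strong_induction_on with
  | _ i ih =>
    intro j hj
    have h1 := hev (k + 1 - j)
    rw [Finset.sum_eq_single j] at h1
    · have e : k + 1 - (j : ℕ) + j = k + 1 := by omega
      rw [e, Nat.choose_self] at h1
      simpa using h1
    · intro b _ hb
      have hb' : (b : ℕ) ≠ j := fun h => hb (Fin.ext h)
      rcases lt_or_gt_of_ne hb' with h2 | h2
      · rw [Nat.choose_eq_zero_of_lt (by omega)]
        simp
      · rw [ih (k - b) (by omega) b rfl, zero_mul]
    · simp

end Independence

/-! ### Order-preserving maps, special orderings and the two polynomials -/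

section Main

variable {n m : ℕ} {D : Digraph (Fin n)} {u : Fin n}

theorem mem_respectingOrderings_iff (hD : IsAcyclic D) {l : List (Fin n)} :
    l ∈ respectingOrderings D ↔ IsTopo D.Adj (fun _ => True) l := by
  have hmem : (∀ v, v ∈ l) ↔ ∀ v, v ∈ l ↔ True := by simp
  change l.Nodup ∧ (∀ v, v ∈ l) ∧ _ ↔ l.Nodup ∧ _ ∧ _
  rw [← hmem, List.pairwise_iff_get]
  refine and_congr_right fun _ => and_congr_right fun _ => ⟨?_, ?_⟩
  · intro h i j hij hji
    exact lt_asymm hij (h j i hji)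
  · intro h i j hij
    rcases lt_trichotomy i j with h1 | h1 | h1
    · exact h1
    · subst h1
      exact absurd (.single hij) (hD _)
    · exact absurd hij (h j i h1)

theorem delta_le_one (a b : Fin n) : delta D a b ≤ 1 := by
  unfold delta
  split_ifs <;> omega

/-- The labels refined by the values of a map: compare the values first. -/
def lexKey (f : Fin n → Fin m) (v : Fin n) : Fin m ×ₗ Fin n := toLex (f v, v)

theorem lexKey_lt {f : Fin n → Fin m} {a b : Fin n} :
    lexKey f a < lexKey f b ↔ f a < f b ∨ f a = f b ∧ a < b := by
  simp [lexKey, Prod.Lex.toLex_lt_toLex]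

theorem lexKey_injective (f : Fin n → Fin m) : Function.Injective (lexKey f) := by
  intro a b h
  have := congrArg (fun x => (ofLex x).2) h
  simpa [lexKey] using this

/-- `f` is order-preserving. -/
def Preserves (D : Digraph (Fin n)) (f : Fin n → Fin m) : Prop :=
  ∀ ⦃a b⦄, D.Adj a b → f a ≤ f b

/-- `delta` relaxes the inequality to a weak one. Equality of values is then allowed exactly for a
label ascent or an arc, and along an arc the weak inequality is automatic. -/
theorem gap_iff_step {f : Fin n → Fin m} (hf : Preserves D f) {e : Fin n → Fin n → Prop}
    {a b : Fin n} (he : ¬ e a b) :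
    Gap e (delta D) f a b ↔ Step (lexKey f) D.Adj a b := by
  unfold Gap Step delta
  rw [lexKey_lt]
  simp only [he, false_implies, not_false_eq_true, true_implies, true_and]
  split_ifs with h
  · constructor
    · intro h1
      rcases (Fin.le_def.2 (by omega : (f a : ℕ) ≤ f b)).lt_or_eq with h2 | h2
      · exact Or.inl (Or.inl h2)
      · exact h.imp_left fun h => Or.inr ⟨h2, h⟩
    · rintro ((h1 | h1) | h1)
      · have := Fin.lt_def.1 h1
        omega
      · rw [h1.1]
      · have := Fin.le_def.1 (hf h1)
        omega
  · rw [not_or] at h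
    simp only [h.1, h.2, and_false, or_false, add_zero]
    rw [Fin.lt_def]
    omega

theorem preserves_of_chain {f : Fin n → Fin m} {l : List (Fin n)} {e : Fin n → Fin n → Prop}
    (hl : IsTopo D.Adj (fun _ => True) l) (hc : l.IsChain (Gap e (delta D) f)) : Preserves D f := by
  have h1 : l.IsChain fun a b => f a ≤ f b := by
    refine hc.imp fun a b h => ?_
    by_cases he : e a b
    · exact (h.1 he).le
    · have := h.2 he
      have := delta_le_one (D := D) a b
      rw [Fin.le_def]
      omega
  have tr : Trans (fun a b => f a ≤ f b) (fun a b => f a ≤ f b) (fun a b => f a ≤ f b) :=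
    ⟨fun h1 h2 => le_trans h1 h2⟩
  have h2 := List.isChain_iff_pairwise.1 h1
  have h3 := (List.pairwise_and_iff.2 ⟨h2, hl.2.2⟩)
  rw [List.pairwise_iff_getElem] at h3
  intro a b hab
  obtain ⟨i, hi, rfl⟩ := List.getElem_of_mem ((hl.2.1 a).2 trivial)
  obtain ⟨j, hj, rfl⟩ := List.getElem_of_mem ((hl.2.1 b).2 trivial)
  rcases lt_trichotomy i j with h | h | h
  · exact (h3 i j hi hj h).1
  · subst h
    exact le_rfl
  · exact absurd hab (h3 j i hj hi h).2

/-- Pairs one of whose members is `u`. -/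
def Touches (u a b : Fin n) : Prop := a = u ∨ b = u

theorem chain_touches_iff {f : Fin n → Fin m} {l₁ l₂ : List (Fin n)} {a b : Fin n}
    (hf : Preserves D f) (hnd : (l₁ ++ a :: u :: b :: l₂).Nodup) :
    (l₁ ++ a :: u :: b :: l₂).IsChain (Gap (Touches u) (delta D) f) ↔
      (f a = f u ∧ f u = f b) ∧ (l₁ ++ [a]).IsChain (Step (lexKey f) D.Adj) ∧
        (b :: l₂).IsChain (Step (lexKey f) D.Adj) := by
  have e : l₁ ++ a :: u :: b :: l₂ = (l₁ ++ [a]) ++ u :: (b :: l₂) := by simp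
  rw [List.isChain_append_cons_cons, List.isChain_cons_cons]
  rw [e, List.perm_middle.nodup_iff, List.nodup_cons, List.mem_append, not_or] at hnd
  have off : ∀ l : List (Fin n), u ∉ l →
      (l.IsChain (Gap (Touches u) (delta D) f) ↔ l.IsChain (Step (lexKey f) D.Adj)) := by
    intro l hl
    have : ∀ a ∈ l, ∀ b ∈ l, ¬ Touches u a b := by
      rintro a ha b hb (rfl | rfl)
      · exact hl ha
      · exact hl hb
    exact List.IsChain.iff_of_mem_imp fun a b ha hb => gap_iff_step hf (this a ha b hb)
  rw [off _ hnd.1.1, off _ hnd.1.2]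
  simp only [Gap, Touches, or_true, true_or, true_implies, not_true, false_implies, and_true]
  tauto

/-- The orderings in which `u` is the middle of a triple of one of the two special shapes. -/
def shapedOrderings (D : Digraph (Fin n)) (u : Fin n) : Set (List (Fin n)) :=
  {l | l ∈ respectingOrderings D ∧ ∃ l₁ a b l₂, l = l₁ ++ a :: u :: b :: l₂ ∧
    (LowMiddle id D.Adj u a b ∨ BetweenMiddle id D.Adj u a b)}

theorem tripleSet_iff {a b c : Fin n} (hab : a < b) (hbc : b < c) (W : Finset (Fin n))
    (hW : ∀ x, x ∈ W ↔ x = a ∨ x = b ∨ x = c) :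
    W ∈ tripleSet D ↔ D.Adj c a ∧ Incomp D.Adj a b ∧ Incomp D.Adj c b := by
  constructor
  · rintro ⟨a', b', c', rfl, hab', hbc', h1, h2, h3⟩
    have ha := (hW a').1 (by simp)
    have hb := (hW b').1 (by simp)
    have hc := (hW c').1 (by simp)
    obtain ⟨rfl, rfl, rfl⟩ : a' = a ∧ b' = b ∧ c' = c := by
      -- A set has only one increasing enumeration, so all other assignments contradict the order.
      rcases ha with rfl | rfl | rfl <;> rcases hb with rfl | rfl | rfl <;>
        rcases hc with rfl | rfl | rfl <;> first | exact ⟨rfl, rfl, rfl⟩ | (exfalso; omega)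
    exact ⟨h1, h2, h3⟩
  · rintro ⟨h1, h2, h3⟩
    refine ⟨a, b, c, ?_, hab, hbc, h1, h2, h3⟩
    ext x
    rw [hW]
    simp

theorem incomp_symm {V : Type*} {adj : V → V → Prop} {a b : V} :
    Incomp adj a b ↔ Incomp adj b a := and_comm

theorem lowMiddle_iff {a b : Fin n} :
    LowMiddle id D.Adj u a b ↔ ({a, u, b} : Finset (Fin n)) ∈ tripleSet D ∧ a > b ∧ b > u := by
  constructor
  · rintro ⟨h1, h2, h3, h4, h5⟩
    exact ⟨(tripleSet_iff h1 h2 _ (by simp; tauto)).2 ⟨h3, incomp_symm.1 h5, incomp_symm.1 h4⟩,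
      h2, h1⟩
  · rintro ⟨h, h2, h1⟩
    obtain ⟨h3, h4, h5⟩ := (tripleSet_iff h1 h2 _ (by simp; tauto)).1 h
    exact ⟨h1, h2, h3, incomp_symm.1 h5, incomp_symm.1 h4⟩

theorem betweenMiddle_iff {a b : Fin n} :
    BetweenMiddle id D.Adj u a b ↔
      ({a, u, b} : Finset (Fin n)) ∈ tripleSet D ∧ a > u ∧ u > b := by
  constructor
  · rintro ⟨h1, h2, h3, h4, h5⟩
    exact ⟨(tripleSet_iff h1 h2 _ (by simp; tauto)).2 ⟨h3, incomp_symm.1 h5, incomp_symm.1 h4⟩,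
      h2, h1⟩
  · rintro ⟨h, h2, h1⟩
    obtain ⟨h3, h4, h5⟩ := (tripleSet_iff h1 h2 _ (by simp; tauto)).1 h
    exact ⟨h1, h2, h3, incomp_symm.1 h5, incomp_symm.1 h4⟩

theorem offSum_decomp (d : Fin n → Fin n → ℕ) (l₁ l₂ : List (Fin n)) (a b : Fin n)
    (hnd : (l₁ ++ a :: u :: b :: l₂).Nodup) :
    offSum (Touches u) d (l₁ ++ a :: u :: b :: l₂) = adjSum d (l₁ ++ [a]) + adjSum d (b :: l₂) := by
  classical
  have e : l₁ ++ a :: u :: b :: l₂ = (l₁ ++ [a]) ++ u :: (b :: l₂) := by simp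
  have off : ∀ l : List (Fin n), u ∉ l → offSum (Touches u) d l = adjSum d l := by
    intro l hl
    refine adjSum_congr l fun a ha b hb => if_neg ?_
    rintro (rfl | rfl)
    · exact hl ha
    · exact hl hb
  rw [e, List.perm_middle.nodup_iff, List.nodup_cons, List.mem_append, not_or] at hnd
  rw [← off _ hnd.1.1, ← off _ hnd.1.2]
  unfold offSum
  rw [adjSum_append_cons, adjSum_cons_cons, adjSum_cons_cons]
  simp [Touches]

theorem deltaList_decomp (l₁ l₂ : List (Fin n)) (a b : Fin n)
    (hnd : (l₁ ++ a :: u :: b :: l₂).Nodup) :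
    deltaList D (l₁ ++ a :: u :: b :: l₂) =
      offSum (Touches u) (delta D) (l₁ ++ a :: u :: b :: l₂) + (delta D a u + delta D u b) := by
  rw [offSum_decomp _ _ _ _ _ hnd]
  change adjSum (delta D) _ = _
  rw [adjSum_append_cons, adjSum_cons_cons, adjSum_cons_cons]
  ring

theorem delta_lowMiddle {a b : Fin n} (h : LowMiddle id D.Adj u a b) :
    delta D a u + delta D u b = 2 := by
  have h1 : delta D a u = 1 := if_pos (Or.inr h.2.2.1)
  have h2 : delta D u b = 1 := if_pos (Or.inl h.1)
  omega

theorem delta_betweenMiddle {a b : Fin n} (h : BetweenMiddle id D.Adj u a b) :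
    delta D a u + delta D u b = 0 := by
  obtain ⟨h1, h2, -, h4, h5⟩ := h
  have e1 : delta D a u = 0 := if_neg (by
    rintro (h | h)
    · exact lt_asymm h h2
    · exact h4.2 (.single h))
  have e2 : delta D u b = 0 := if_neg (by
    rintro (h | h)
    · exact lt_asymm h h1
    · exact h5.1 (.single h))
  omega

/-- The two pairs at `u` contribute `2` to δ in the low shape and `0` in the between shape. So `j +
2` and `j` both say that the other pairs contribute `j`. -/
theorem mem_specialOrderings_iff {j : ℕ} {l : List (Fin n)} :
    l ∈ specialOrderings D u j ↔
      l ∈ shapedOrderings D u ∧ offSum (Touches u) (delta D) l = j := by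
  constructor
  · rintro ⟨hl, l₁, l₂, a, b, h, hW, hc⟩
    have h' : l = l₁ ++ a :: u :: b :: l₂ := by simpa using h
    have hnd := hl.1
    rw [h'] at hnd
    have hdec := deltaList_decomp (D := D) l₁ l₂ a b hnd
    rw [← h'] at hdec
    rcases hc with ⟨h1, h2⟩ | ⟨h1, h2⟩
    · have hlow := lowMiddle_iff.2 ⟨hW, h2⟩
      rw [delta_lowMiddle hlow] at hdec
      exact ⟨⟨hl, l₁, a, b, l₂, h', Or.inl hlow⟩, by omega⟩
    · have hbtw := betweenMiddle_iff.2 ⟨hW, h2⟩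
      rw [delta_betweenMiddle hbtw] at hdec
      exact ⟨⟨hl, l₁, a, b, l₂, h', Or.inr hbtw⟩, by omega⟩
  · rintro ⟨⟨hl, l₁, a, b, l₂, h', hc⟩, hj⟩
    have hnd := hl.1
    rw [h'] at hnd
    have hdec := deltaList_decomp (D := D) l₁ l₂ a b hnd
    rw [← h'] at hdec
    refine ⟨hl, l₁, l₂, a, b, by simpa using h', ?_⟩
    rcases hc with hc | hc
    · rw [delta_lowMiddle hc] at hdec
      obtain ⟨h1, h2⟩ := lowMiddle_iff.1 hc
      exact ⟨h1, Or.inl ⟨by omega, h2⟩⟩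
    · rw [delta_betweenMiddle hc] at hdec
      obtain ⟨h1, h2⟩ := betweenMiddle_iff.1 hc
      exact ⟨h1, Or.inr ⟨by omega, h2⟩⟩

theorem length_eq {l : List (Fin n)} (hl : l ∈ respectingOrderings D) : l.length = n := by
  have h1 : l.toFinset = Finset.univ := by
    ext v
    simp [hl.2.1 v]
  rw [← List.toFinset_card_of_nodup hl.1, h1, Finset.card_univ, Fintype.card_fin]

theorem offSum_one_shaped {l : List (Fin n)} (hl : l ∈ shapedOrderings D u) :
    offSum (Touches u) (fun _ _ => 1) l = n - 3 := by
  obtain ⟨hl, l₁, a, b, l₂, rfl, -⟩ := hl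
  rw [offSum_decomp _ _ _ _ _ hl.1, adjSum_one, adjSum_one]
  have := length_eq hl
  simp at this ⊢
  omega

/-- In either shape the arc descends in key, so its end values agree and squeeze the third. Thus `f`
is constant on `a`, `u`, `b`, where keys compare as labels; this is why `Gap` demands equality at
pairs touching `u`. -/
theorem shaped_and_chain_iff {f : Fin n → Fin m} (hD : IsAcyclic D) (hf : Preserves D f)
    {l : List (Fin n)} :
    l ∈ shapedOrderings D u ∧ l.IsChain (Gap (Touches u) (delta D) f) ↔
      IsTopo D.Adj (fun _ => True) l ∧ StepsAround (lexKey f) D.Adj u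
        (fun a b => LowMiddle (lexKey f) D.Adj u a b ∨ BetweenMiddle (lexKey f) D.Adj u a b) l := by
  have hlt : ∀ {a b}, lexKey f a < lexKey f b → f a ≤ f b := by
    intro a b h
    rcases lexKey_lt.1 h with h | h
    · exact h.le
    · exact h.1.le
  have hlt' : ∀ {a b}, lexKey f a < lexKey f b → f a = f b → a < b := by
    intro a b h he
    rcases lexKey_lt.1 h with h | h
    · exact absurd he h.ne
    · exact h.2
  constructor
  · rintro ⟨⟨hl, l₁, a, b, l₂, rfl, hQ⟩, hc⟩
    obtain ⟨⟨h1, h2⟩, h3, h4⟩ := (chain_touches_iff hf hl.1).1 hc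
    refine ⟨(mem_respectingOrderings_iff hD).1 hl, l₁, a, b, l₂, rfl, ?_, h3, h4⟩
    refine hQ.imp (fun hQ => ⟨?_, ?_, hQ.2.2⟩) (fun hQ => ⟨?_, ?_, hQ.2.2⟩)
    · exact lexKey_lt.2 (Or.inr ⟨h2, hQ.1⟩)
    · exact lexKey_lt.2 (Or.inr ⟨(h1.trans h2).symm, hQ.2.1⟩)
    · exact lexKey_lt.2 (Or.inr ⟨h2.symm, hQ.1⟩)
    · exact lexKey_lt.2 (Or.inr ⟨h1.symm, hQ.2.1⟩)
  · rintro ⟨hl, l₁, a, b, l₂, rfl, hQ, h3, h4⟩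
    rw [chain_touches_iff hf hl.1]
    rcases hQ with ⟨h1, h2, hadj, h5⟩ | ⟨h1, h2, hadj, h5⟩
    · have e1 : f a = f u := le_antisymm (hf hadj) ((hlt h1).trans (hlt h2))
      have e2 : f u = f b := le_antisymm (hlt h1) ((hlt h2).trans (hf hadj))
      exact ⟨⟨(mem_respectingOrderings_iff hD).2 hl, l₁, a, b, l₂, rfl,
        Or.inl ⟨hlt' h1 e2, hlt' h2 (e1.trans e2).symm, hadj, h5⟩⟩, ⟨e1, e2⟩, h3, h4⟩
    · have e1 : f a = f u := le_antisymm ((hf hadj).trans (hlt h1)) (hlt h2)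
      have e2 : f u = f b := le_antisymm ((hlt h2).trans (hf hadj)) (hlt h1)
      exact ⟨⟨(mem_respectingOrderings_iff hD).2 hl, l₁, a, b, l₂, rfl,
        Or.inr ⟨hlt' h1 e2.symm, hlt' h2 e1.symm, hadj, h5⟩⟩, ⟨e1, e2⟩, h3, h4⟩

/-- `T` consists of the levels above `f u` together with the vertices reachable from `u` on its own
level; `hu` is what puts the latter above the rest of that level. An obstructing triple lies on one
level, hence belongs to `tripleSet D`. -/
theorem splitting_lexKey {f : Fin n → Fin m} (hD : IsAcyclic D) (hf : Preserves D f)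
    (hu : ∀ x ∉ reachSet D u, ∀ y ∈ reachSet D u, x < y) (hW : ∀ W ∈ tripleSet D, u ∈ W) :
    Splitting (lexKey f) D.Adj u fun v => (f v = f u ∧ Reaches D u v) ∨ f u < f v where
  inj := lexKey_injective f
  acyclic := hD
  up := by
    rintro a b (⟨h1, h2⟩ | h) hab
    · rcases (hf hab).lt_or_eq with h3 | h3
      · exact Or.inr (h1 ▸ h3)
      · exact Or.inl ⟨h3 ▸ h1, h2.tail hab⟩
    · exact Or.inr (h.trans_le (hf hab))
  not_self := by
    rintro (h | h)
    · exact hD u h.2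
    · exact lt_irrefl _ h
  succ := by
    intro v hv
    rcases (hf hv).lt_or_eq with h | h
    · exact Or.inr h
    · exact Or.inl ⟨h.symm, .single hv⟩
  lt := by
    intro x y hx hy
    rw [not_or, not_and, not_lt] at hx
    rw [lexKey_lt]
    rcases hy with ⟨h1, h2⟩ | hy
    · rw [h1]
      rcases hx.2.lt_or_eq with h3 | h3
      · exact Or.inl h3
      · refine Or.inr ⟨h3, hu x (fun h => hx.1 h3 h.2) y ⟨?_, h2⟩⟩
        rintro rfl
        exact hD _ h2
    · exact Or.inl (hx.2.trans_lt hy)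
  triple := by
    intro a b c hab hbc hca h1 h2
    have hfca := hf hca
    have hfab : f a ≤ f b := (lexKey_lt.1 hab).elim le_of_lt fun h => h.1.le
    have hfbc : f b ≤ f c := (lexKey_lt.1 hbc).elim le_of_lt fun h => h.1.le
    have eab : a < b := ((lexKey_lt.1 hab).resolve_left
      (not_lt.2 (hfbc.trans hfca))).2
    have ebc : b < c := ((lexKey_lt.1 hbc).resolve_left
      (not_lt.2 (hfca.trans hfab))).2
    have := hW {a, b, c} ⟨a, b, c, rfl, eab, ebc, hca, h1, h2⟩
    simp only [Finset.mem_insert, Finset.mem_singleton] at this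
    tauto

theorem omegaPoly_eval (hD : IsAcyclic D) (m : ℕ) :
    (omegaPoly D hD).eval (m : ℚ) = ({f : Fin n → Fin m | Preserves D f}.ncard : ℚ) := by
  rw [omegaPoly, @orderPolynomial_eval_natCast _ _ (closurePoset D hD), ← Nat.card_coe_set_eq]
  congr 1
  let _ := closurePoset D hD
  refine Nat.card_congr
    { toFun := fun f => ⟨f, fun a b hab => f.monotone (Relation.ReflTransGen.single hab)⟩
      invFun := fun f => ⟨f.1, fun a b hab => ?_⟩
      left_inv := fun f => rfl
      right_inv := fun f => rfl }
  induction hab with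
  | refl => exact le_rfl
  | tail _ h ih => exact ih.trans (f.2 h)

theorem psiPoly_eval (hn : n ≠ 0) (m : ℕ) :
    (psiPoly D).eval (m : ℚ) = ((∑ f : Fin n → Fin m, {l | l ∈ (finite_respectingOrderings D).toFinset
      ∧ l.IsChain (Gap (fun _ _ => False) (delta D) f)}.ncard : ℕ) : ℚ) := by
  rw [← sum_ncard_comm, psiPoly, eval_finsetSum, Nat.cast_sum]
  refine Finset.sum_congr rfl fun l hl => ?_
  rw [Set.Finite.mem_toFinset] at hl
  have hlen := length_eq hl
  have hne : l ≠ [] := by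
    rintro rfl
    exact hn hlen.symm
  rw [ncard_gap_chain _ _ delta_le_one hne hl.1 hl.2.1, binomPoly_eval_natCast]
  have e1 : offSum (fun _ _ => False) (delta D) l = deltaList D l := by
    simp [offSum, adjSum, deltaList]
  have e2 : offSum (fun _ _ => False) (fun _ _ => 1) l + 1 = n := by
    have := adjSum_one l
    simp only [offSum, if_false]
    omega
  rw [e1, e2, Fintype.card_fin]

theorem finite_shapedOrderings (D : Digraph (Fin n)) (u : Fin n) : (shapedOrderings D u).Finite :=
  (finite_respectingOrderings D).subset fun _ hl => hl.1

/-- Double counting of pairs of a map and a shaped ordering, with the orderings grouped by `offSum`.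
-/
theorem sum_special_eval (hn : 3 ≤ n) (m : ℕ) :
    ∑ j : Fin (n - 2), (specialOrderings D u j).ncard * (m + j).choose (n - 2) =
      ∑ f : Fin n → Fin m, {l | l ∈ (finite_shapedOrderings D u).toFinset
        ∧ l.IsChain (Gap (Touches u) (delta D) f)}.ncard := by
  classical
  rw [← sum_ncard_comm]
  have h1 : ∀ l ∈ (finite_shapedOrderings D u).toFinset,
      {f : Fin n → Fin m | l.IsChain (Gap (Touches u) (delta D) f)}.ncard =
        (m + offSum (Touches u) (delta D) l).choose (n - 2) := by
    intro l hl
    rw [Set.Finite.mem_toFinset] at hl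
    have hne : l ≠ [] := by
      rintro rfl
      have := length_eq hl.1
      simp at this
      omega
    rw [ncard_gap_chain _ _ delta_le_one hne hl.1.1 hl.1.2.1, offSum_one_shaped hl]
    congr 1
    omega
  rw [Finset.sum_congr rfl h1]
  have hlt : ∀ l ∈ (finite_shapedOrderings D u).toFinset,
      offSum (Touches u) (delta D) l < n - 2 := by
    intro l hl
    rw [Set.Finite.mem_toFinset] at hl
    have h2 : offSum (Touches u) (delta D) l ≤ offSum (Touches u) (fun _ _ => 1) l := by
      refine adjSum_le_adjSum _ fun a _ b _ => ?_
      split_ifs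
      · exact le_rfl
      · exact delta_le_one a b
    rw [offSum_one_shaped hl] at h2
    omega
  rw [Fin.sum_univ_eq_sum_range
    (fun j => (specialOrderings D u j).ncard * (m + j).choose (n - 2)),
    ← Finset.sum_fiberwise_of_maps_to (t := Finset.range (n - 2))
      fun l hl => Finset.mem_range.2 (hlt l hl)]
  refine Finset.sum_congr rfl fun j _ => ?_
  rw [Finset.sum_congr rfl (g := fun _ => (m + j).choose (n - 2))
    fun l hl => by rw [(Finset.mem_filter.1 hl).2], Finset.sum_const, smul_eq_mul,
    ← Set.ncard_coe_finset]
  congr 2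
  ext l
  rw [mem_specialOrderings_iff]
  simp

theorem psiPoly_sub_omegaPoly (hn : 3 ≤ n) (hD : IsAcyclic D)
    (hu : ∀ x ∉ reachSet D u, ∀ y ∈ reachSet D u, x < y) (hW : ∀ W ∈ tripleSet D, u ∈ W) :
    psiPoly D - omegaPoly D hD = ∑ j : Fin (n - 2),
      C ((specialOrderings D u j).ncard : ℚ) * binomPoly (j : ℕ) (n - 2) := by
  classical
  have heval : ∀ m : ℕ, (psiPoly D - omegaPoly D hD).eval (m : ℚ) =
      (∑ j : Fin (n - 2), C ((specialOrderings D u j).ncard : ℚ) *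
        binomPoly (j : ℕ) (n - 2)).eval (m : ℚ) := by
    intro m
    have hΩ : {f : Fin n → Fin m | Preserves D f}.ncard =
        ∑ f : Fin n → Fin m, if Preserves D f then 1 else 0 := by
      rw [← Finset.card_filter, ← Set.ncard_coe_finset]
      simp
    rw [eval_sub, omegaPoly_eval, psiPoly_eval (by omega), sub_eq_iff_eq_add, eval_finsetSum]
    simp only [eval_mul, eval_C, binomPoly_eval_natCast]
    norm_cast
    rw [sum_special_eval hn, hΩ, ← Finset.sum_add_distrib]
    refine Finset.sum_congr rfl fun f _ => ?_
    -- An order-preserving `f` gives the splitting count; for any other `f` both sets of orderings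
    -- are empty, because values rise weakly along either kind of chain.
    by_cases hf : Preserves D f
    · rw [if_pos hf, add_comm]
      convert (splitting_lexKey hD hf hu hW).ncard_chain_eq using 2
      · ext l
        rw [Set.mem_ofPred_eq, Set.mem_ofPred_eq, Set.Finite.mem_toFinset,
          mem_respectingOrderings_iff hD]
        exact and_congr_right fun _ => List.IsChain.iff fun a b => gap_iff_step hf not_false
      · congr 1
        ext l
        rw [Set.mem_ofPred_eq, Set.mem_ofPred_eq, Set.Finite.mem_toFinset]
        exact shaped_and_chain_iff hD hf
    · have e1 : {l | l ∈ (finite_respectingOrderings D).toFinset ∧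
          l.IsChain (Gap (fun _ _ => False) (delta D) f)} = ∅ := by
        refine Set.eq_empty_iff_forall_notMem.2 fun l hl => hf ?_
        rw [Set.mem_ofPred_eq, Set.Finite.mem_toFinset, mem_respectingOrderings_iff hD] at hl
        exact preserves_of_chain hl.1 hl.2
      have e2 : {l | l ∈ (finite_shapedOrderings D u).toFinset ∧
          l.IsChain (Gap (Touches u) (delta D) f)} = ∅ := by
        refine Set.eq_empty_iff_forall_notMem.2 fun l hl => hf ?_
        rw [Set.mem_ofPred_eq, Set.Finite.mem_toFinset] at hl
        exact preserves_of_chain ((mem_respectingOrderings_iff hD).1 hl.1.1) hl.2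
      rw [if_neg hf, e1, e2, add_zero]
  refine eq_of_infinite_eval_eq _ _ (Set.infinite_of_injective_forall_mem
    (Nat.cast_injective (R := ℚ)) heval)

end Main

end OrderPoly

/-- The labels `1, …, n` are represented by `Fin n` with its natural order. -/
theorem mainTheorem6 (n : ℕ) (hn : 3 ≤ n) (D : Digraph (Fin n)) (hD : OrderPoly.IsAcyclic D)
    (u : Fin n)
    (hu : OrderPoly.IsSink D u ∨
      ((∀ x ∉ OrderPoly.reachSet D u, ∀ y ∈ OrderPoly.reachSet D u, x < y) ∧
        ∀ y ∈ OrderPoly.reachSet D u, ¬ OrderPoly.IsSink D y →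
          ∀ z ∈ OrderPoly.reachSet D y, y < z))
    (hW : ∀ W ∈ OrderPoly.tripleSet D, u ∈ W)
    (d : Fin (n - 2) → ℚ) :
    OrderPoly.psiPoly D - OrderPoly.omegaPoly D hD =
        ∑ j : Fin (n - 2), Polynomial.C (d j) * OrderPoly.binomPoly (j : ℕ) (n - 2) ↔
      ∀ j : Fin (n - 2), d j = ((OrderPoly.specialOrderings D u (j : ℕ)).ncard : ℚ) := by
  -- For a sink the reach set is empty and the condition is vacuous.
  have hu' : ∀ x ∉ OrderPoly.reachSet D u, ∀ y ∈ OrderPoly.reachSet D u, x < y := by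
    rcases hu with hu | hu
    · rintro x - y ⟨-, hy⟩
      obtain ⟨z, hz, -⟩ := Relation.TransGen.head'_iff.1 hy
      exact absurd hz (hu z)
    · exact hu.1
  rw [OrderPoly.psiPoly_sub_omegaPoly hn hD hu' hW]
  constructor
  · intro h
    obtain ⟨k, rfl⟩ : ∃ k, n = k + 3 := ⟨n - 3, by omega⟩
    intro j
    refine sub_eq_zero.1 (OrderPoly.eq_zero_of_sum_binomPoly_eq_zero (k := k)
      (c := fun j => d j - ((OrderPoly.specialOrderings D u (j : ℕ)).ncard : ℚ)) ?_ j)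
    simp only [Polynomial.C_sub, sub_mul, Finset.sum_sub_distrib]
    exact sub_eq_zero.2 h.symm
  · intro h
    exact Finset.sum_congr rfl fun j _ => by rw [h j]
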